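/- Let $\kappa$ be a measurable cardinal, i.e. an uncountable cardinal carrying a nonprincipal $\kappa$-complete ultrafilter, and let $K=(K,\prec_K)$ be an abstract elementary class that is essentially below $\kappa$: either $LS(K)<\kappa$, or $K=(\mathrm{Mod}\,T,\prec_{\mathcal F})$ where $T$ is a theory in a fragment $\mathcal F$ of $L_{\kappa,\omega}$. No amalgamation is assumed. Galois types are defined as follows. For $M\in K$ with $\|M\|\ge LS(K)$ and an index set $I$, a pretype over $M$ is a triple $(\langle a_i:i\in I\rangle,M,N)$ with $M\prec_K N\in K$, $\|N\|=\|M\|+|I|$ and all $a_i\in |N|$. Two pretypes $(\bar a,M,N)$, $(\bar b,M,N')$ are atomically equivalent if there are $K$-embeddings $f:N\to N^*$, $g:N'\to N^*$ into some $N^*\in K$ that agree on $M$ and satisfy $f(a_i)=g(b_i)$ for all $i\in I$. The set $S^I(M)$ of types of length $I$ over $M$ is the set of classes of pretypes under the transitive closure of atomic equivalence. For $N\prec_K M$ and $J\subseteq I$, $p\upharpoonright N\in S^I(N)$ and $p^{J}\in S^{J}(M)$ denote the restrictions of $p \in S^I(M)$ to the model $N$ and to the subsequence indexed by $J$. Then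 the following hold. 1. If $LS(K)<\kappa$, then $K$ is fully $(<\kappa,\kappa)$-tame. 2. For every cardinal $\lambda>LS(K)$ with $\mathrm{cf}\,\lambda=\kappa$, $K$ is fully $(<\lambda,\lambda)$-tame and fully $(<\lambda,\lambda)$-type short. Here, fully $(<\lambda,\lambda)$-tame means that for every $I$, every $M\in K$ with $\|M\|=\lambda$ and all $p\ne q$ in $S^I(M)$, there is $N\prec_K M$ with $LS(K)\le\|N\|<\lambda$ and $p\upharpoonright N\ne q\upharpoonright N$. Fully $(<\lambda,\lambda)$-type short means that for every $M\in K$ with $\|M\|\ge LS(K)$, every $I$ with $|I|=\lambda$ and all $p\neq q$ in $S^I(M)$, there is $J\subseteq I$ with $|J|<\lambda$ and $p^{J}\ne q^{J}$. -/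

import Mathlib

open Cardinal FirstOrder FirstOrder.Language

universe u

/-! ### Abstract elementary classes -/

/-- An abstract elementary class `(K, ≺_K)` in the language `L`. All languages, models and index
sets live in one universe `Type u`, which plays the role of the universe of sets.

`Mem M` says that the `L`-structure `M` is in `K`. Up to renaming elements, a pair `M ≺_K N` is an
`L`-structure `N` together with a substructure of it, and `Strong S` says `S ≺_K N` for a
substructure `S` of `N`. For substructures `S ≤ T` of `N`, the relation `S ≺_K T` is
`Strong (S.comap T.subtype.toHom)`, where the comap is `S` regarded as a substructure of `T`. -/
structure AEC (L : FirstOrder.Language.{u, u}) where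
  /-- membership in the class -/
  Mem : (M : Type u) → [L.Structure M] → Prop
  /-- the strong substructure relation `S ≺_K N` -/
  Strong : {N : Type u} → [L.Structure N] → L.Substructure N → Prop
  nonempty_of_mem : ∀ (M : Type u) [L.Structure M], Mem M → Nonempty M
  /-- `≺_K` is a relation on `K` -/
  mem_of_strong : ∀ {N : Type u} [L.Structure N] (S : L.Substructure N), Strong S → Mem S ∧ Mem N
  /-- reflexivity -/
  strong_top : ∀ (N : Type u) [L.Structure N], Mem N → Strong (⊤ : L.Substructure N)
  /-- transitivity (antisymmetry holds automatically for substructures) -/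
  strong_trans : ∀ {N : Type u} [L.Structure N] (S T : L.Substructure N), S ≤ T →
    Strong (S.comap T.subtype.toHom) → Strong T → Strong S
  /-- invariance under isomorphism of the class -/
  mem_of_equiv : ∀ {N N' : Type u} [L.Structure N] [L.Structure N'], (N ≃[L] N') → Mem N → Mem N'
  /-- invariance under isomorphism of the relation -/
  strong_of_equiv : ∀ {N N' : Type u} [L.Structure N] [L.Structure N'] (f : N ≃[L] N')
    (S : L.Substructure N), Strong S → Strong (S.map f.toEmbedding.toHom)
  /-- coherence -/
  coherence : ∀ {N : Type u} [L.Structure N] (S T : L.Substructure N), S ≤ T →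
    Strong S → Strong T → Strong (S.comap T.subtype.toHom)
  /-- the union `N` of a nonempty `≺_K`-increasing continuous chain is in `K` and is a
  `≺_K`-extension of the members of the chain -/
  union_chain : ∀ {N : Type u} [L.Structure N] {ι : Type u} [LinearOrder ι] [WellFoundedLT ι]
    [Nonempty ι] (S : ι → L.Substructure N),
    (∀ i, Mem (S i)) →
    (∀ i j, i ≤ j → S i ≤ S j ∧ Strong ((S i).comap (S j).subtype.toHom)) →
    (∀ i, Order.IsSuccLimit i → S i = ⨆ j : Set.Iio i, S j) →
    (⨆ i, S i) = ⊤ →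
    Mem N ∧ ∀ i, Strong (S i)
  /-- if all members of such a chain are `≺_K N`, then so is the union -/
  union_chain_strong : ∀ {N : Type u} [L.Structure N] {ι : Type u} [LinearOrder ι]
    [WellFoundedLT ι] [Nonempty ι] (S : ι → L.Substructure N),
    (∀ i, Strong (S i)) →
    (∀ i j, i ≤ j → S i ≤ S j ∧ Strong ((S i).comap (S j).subtype.toHom)) →
    (∀ i, Order.IsSuccLimit i → S i = ⨆ j : Set.Iio i, S j) →
    Strong (⨆ i, S i)
  /-- there is a Löwenheim-Skolem number -/
  exists_ls : ∃ μ : Cardinal.{u}, L.card + ℵ₀ ≤ μ ∧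
    ∀ (M : Type u) [L.Structure M], Mem M → ∀ A : Set M,
      ∃ S : L.Substructure M, Strong S ∧ A ⊆ S ∧ #S ≤ #A + μ

namespace AEC

variable {L : FirstOrder.Language.{u, u}} (K : AEC L)

/-- The Löwenheim-Skolem number `LS(K)`: the least `μ ≥ |L| + ℵ₀` such that every subset `A` of
every `M ∈ K` is contained in some `S ≺_K M` with `‖S‖ ≤ |A| + μ`. -/
noncomputable def LS : Cardinal.{u} :=
  sInf {μ : Cardinal.{u} | L.card + ℵ₀ ≤ μ ∧
    ∀ (M : Type u) [L.Structure M], K.Mem M → ∀ A : Set M,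
      ∃ S : L.Substructure M, K.Strong S ∧ A ⊆ S ∧ #S ≤ #A + μ}

theorem LS_spec : L.card + ℵ₀ ≤ K.LS ∧
    ∀ (M : Type u) [L.Structure M], K.Mem M → ∀ A : Set M,
      ∃ S : L.Substructure M, K.Strong S ∧ A ⊆ S ∧ #S ≤ #A + K.LS :=
  csInf_mem (s := {μ : Cardinal.{u} | L.card + ℵ₀ ≤ μ ∧
    ∀ (M : Type u) [L.Structure M], K.Mem M → ∀ A : Set M,
      ∃ S : L.Substructure M, K.Strong S ∧ A ⊆ S ∧ #S ≤ #A + μ}) K.exists_ls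

theorem aleph0_le_LS : ℵ₀ ≤ K.LS := le_trans le_add_self K.LS_spec.1

/-- A `K`-embedding is an embedding `f : M → N` with `f(M) ≺_K N`. -/
def IsEmb {M N : Type u} [L.Structure M] [L.Structure N] (f : M ↪[L] N) : Prop :=
  K.Strong f.toHom.range

variable {K}

theorem IsEmb.mem_right {M N : Type u} [L.Structure M] [L.Structure N] {f : M ↪[L] N}
    (hf : K.IsEmb f) : K.Mem N := (K.mem_of_strong _ hf).2

theorem IsEmb.comp {M N P : Type u} [L.Structure M] [L.Structure N] [L.Structure P]
    {g : N ↪[L] P} {f : M ↪[L] N} (hg : K.IsEmb g) (hf : K.IsEmb f) : K.IsEmb (g.comp f) := by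
  refine K.strong_trans _ g.toHom.range ?_ ?_ hg
  · rintro _ ⟨x, rfl⟩
    exact ⟨f x, rfl⟩
  · have h := K.strong_of_equiv g.equivRange _ hf
    convert h using 1
    ext ⟨y, hy⟩
    obtain ⟨n, rfl⟩ := hy
    constructor
    · rintro ⟨x, hx⟩
      exact ⟨f x, ⟨x, rfl⟩, Subtype.ext hx⟩
    · rintro ⟨_, ⟨x, rfl⟩, hx⟩
      exact ⟨x, congrArg Subtype.val hx⟩

theorem isEmb_subtype {N : Type u} [L.Structure N] {S : L.Substructure N} (hS : K.Strong S) :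
    K.IsEmb S.subtype := by
  unfold IsEmb
  rwa [Substructure.range_subtype]

theorem isEmb_refl {N : Type u} [L.Structure N] (hN : K.Mem N) :
    K.IsEmb (Embedding.refl L N) := by
  unfold IsEmb
  convert K.strong_top N hN
  ext x
  exact ⟨fun _ => trivial, fun _ => ⟨x, rfl⟩⟩

theorem IsEmb.codRestrict {M N : Type u} [L.Structure M] [L.Structure N] {f : M ↪[L] N}
    (hf : K.IsEmb f) {T : L.Substructure N} (hT : K.Strong T) (h : ∀ x, f x ∈ T) :
    K.IsEmb (Embedding.codRestrict T f h) := by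
  have := K.coherence f.toHom.range T (by rintro _ ⟨x, rfl⟩; exact h x) hf hT
  unfold IsEmb
  convert this using 1
  ext ⟨y, hy⟩
  constructor
  · rintro ⟨x, hx⟩
    exact ⟨x, congrArg Subtype.val hx⟩
  · rintro ⟨x, hx⟩
    exact ⟨x, Subtype.ext hx⟩

variable (K)

/-! ### Galois types -/

/-- A pretype `(⟨a_i : i ∈ I⟩, M, N)` over the base model `M`: here `M ≺_K N`
(given by a `K`-embedding of `M` in `N`), `‖N‖ = ‖M‖ + |I|` and every `a_i` is in `N`. -/
structure Pretype (M : Type u) [L.Structure M] (I : Type u) where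
  /-- the ambient model -/
  N : Type u
  [str : L.Structure N]
  /-- the inclusion of the base -/
  incl : M ↪[L] N
  isEmb : K.IsEmb incl
  card_eq : #N = #M + #I
  /-- the sequence -/
  a : I → N

attribute [instance] Pretype.str

variable {K}

/-- Atomic equivalence `∼_AT`: both ambient models embed in some `N* ∈ K`, with the same
restriction to `M`, in such a way that the two sequences have the same image. -/
def Pretype.Atomic {M : Type u} [L.Structure M] {I : Type u} (P Q : Pretype K M I) : Prop :=
  ∃ (N' : Type u) (_ : L.Structure N') (f : P.N ↪[L] N') (g : Q.N ↪[L] N'),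
    K.IsEmb f ∧ K.IsEmb g ∧ (∀ m, f (P.incl m) = g (Q.incl m)) ∧ ∀ i, f (P.a i) = g (Q.a i)

theorem Pretype.Atomic.refl {M : Type u} [L.Structure M] {I : Type u} (P : Pretype K M I) :
    P.Atomic P :=
  ⟨P.N, P.str, Embedding.refl L _, Embedding.refl L _, isEmb_refl P.isEmb.mem_right,
    isEmb_refl P.isEmb.mem_right, fun _ => rfl, fun _ => rfl⟩

theorem Pretype.Atomic.symm {M : Type u} [L.Structure M] {I : Type u} {P Q : Pretype K M I}
    (h : P.Atomic Q) : Q.Atomic P := by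
  obtain ⟨N', s, f, g, hf, hg, h1, h2⟩ := h
  exact ⟨N', s, g, f, hg, hf, fun m => (h1 m).symm, fun i => (h2 i).symm⟩

variable (K)

/-- The relation `∼`, the transitive closure of `∼_AT`. -/
def Pretype.setoid (M : Type u) [L.Structure M] (I : Type u) : Setoid (Pretype K M I) where
  r := Relation.TransGen Pretype.Atomic
  iseqv :=
    { refl := fun P => .single (Pretype.Atomic.refl P)
      symm := fun h => by
        induction h with
        | single h => exact .single h.symm
        | tail _ h ih => exact .head h.symm ih
      trans := fun h h' => h.trans h' }

/-- The set `S^I(M)` of Galois types of length `I` over `M`. -/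
def GaloisType (M : Type u) [L.Structure M] (I : Type u) : Type (u + 1) :=
  Quotient (Pretype.setoid K M I)

variable {K}

/-- `Q = (⟨b_j : j ∈ J⟩, M', N')` is a restriction of `P = (⟨a_i : i ∈ I⟩, M, N)` along
`e : M' → M` and `s : J → I`: up to an identification of `N'` with its image,
`M' ≺_K N' ≺_K N` and `b_j = a_{s j}`. -/
def Pretype.IsRestr {M M' : Type u} [L.Structure M] [L.Structure M'] {I J : Type u}
    (e : M' ↪[L] M) (s : J → I) (P : Pretype K M I) (Q : Pretype K M' J) : Prop :=
  ∃ k : Q.N ↪[L] P.N, K.IsEmb k ∧ (∀ m, k (Q.incl m) = P.incl (e m)) ∧ ∀ j, k (Q.a j) = P.a (s j)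

theorem Pretype.exists_isRestr {M M' : Type u} [L.Structure M] [L.Structure M'] {I J : Type u}
    (e : M' ↪[L] M) (he : K.IsEmb e) (s : J → I) (hs : Function.Injective s) (hLS : K.LS ≤ #M')
    (P : Pretype K M I) : ∃ Q : Pretype K M' J, P.IsRestr e s Q := by
  set c : Cardinal.{u} := #M' + #J with hc
  have hMc : #M' ≤ c := le_self_add
  have hinf : ℵ₀ ≤ c := (K.aleph0_le_LS.trans hLS).trans hMc
  have hcN : c ≤ #P.N := by
    rw [P.card_eq]
    exact add_le_add (mk_le_of_injective e.injective) (mk_le_of_injective hs)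
  obtain ⟨B, hB⟩ := le_mk_iff_exists_set.1 hcN
  let f : M' ↪[L] P.N := P.incl.comp e
  have hf : K.IsEmb f := P.isEmb.comp he
  obtain ⟨T, hT, hA, hcard⟩ := K.LS_spec.2 P.N P.isEmb.mem_right
    ((Set.range f ∪ Set.range (P.a ∘ s)) ∪ B)
  have hTc : #T = c := by
    apply le_antisymm
    · refine hcard.trans ?_
      refine (add_le_add (mk_union_le _ _) (hLS.trans hMc)).trans ?_
      refine (add_le_add_left (add_le_add_left (mk_union_le _ _) _) _).trans ?_
      have h1 : #(Set.range f) ≤ c := mk_range_le.trans hMc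
      have h2 : #(Set.range (P.a ∘ s)) ≤ c := mk_range_le.trans le_add_self
      refine (add_le_add_left (add_le_add (add_le_add h1 h2) hB.le) c).trans ?_
      rw [add_eq_self hinf, add_eq_self hinf, add_eq_self hinf]
    · rw [← hB]
      exact mk_le_mk_of_subset (Set.subset_union_right.trans hA)
  have hfT : ∀ x, f x ∈ T := fun x => hA (Or.inl (Or.inl ⟨x, rfl⟩))
  refine ⟨⟨T, Embedding.codRestrict T f hfT, hf.codRestrict hT hfT, hTc,
    fun j => ⟨P.a (s j), hA (Or.inl (Or.inr ⟨j, rfl⟩))⟩⟩, T.subtype, isEmb_subtype hT, ?_, ?_⟩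
  · intro m
    rfl
  · intro j
    rfl

/-- Restrictions of atomically equivalent pretypes are atomically equivalent. -/
theorem Pretype.IsRestr.atomic {M M' : Type u} [L.Structure M] [L.Structure M'] {I J : Type u}
    {e : M' ↪[L] M} {s : J → I} {P P' : Pretype K M I} {Q Q' : Pretype K M' J}
    (h : P.IsRestr e s Q) (h' : P'.IsRestr e s Q') (hP : P.Atomic P') : Q.Atomic Q' := by
  obtain ⟨k, hk, hk1, hk2⟩ := h
  obtain ⟨k', hk', hk1', hk2'⟩ := h'
  obtain ⟨N', _, f, g, hf, hg, h1, h2⟩ := hP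
  refine ⟨N', _, f.comp k, g.comp k', hf.comp hk, hg.comp hk', fun m => ?_, fun i => ?_⟩
  · simp only [Embedding.comp_apply, hk1, hk1', h1]
  · simp only [Embedding.comp_apply, hk2, hk2', h2]

/-- The type of `⟨a_{s j} : j ∈ J⟩` over `M'`, where `tp(⟨a_i : i ∈ I⟩ / M, N)` is given,
`e : M' → M` is a `K`-embedding and `s : J → I` is injective. It is the class of any restriction of
any representative. -/
noncomputable def GaloisType.pullback {M M' : Type u} [L.Structure M] [L.Structure M']
    {I J : Type u} (e : M' ↪[L] M) (he : K.IsEmb e) (s : J → I) (hs : Function.Injective s)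
    (hLS : K.LS ≤ #M') (p : GaloisType K M I) : GaloisType K M' J :=
  Quotient.map (sa := Pretype.setoid K M I) (sb := Pretype.setoid K M' J)
    (fun P => (Pretype.exists_isRestr e he s hs hLS P).choose)
    (fun P₀ P₁ h => Relation.TransGen.lift _ (fun P P' hP =>
      (Pretype.exists_isRestr e he s hs hLS P).choose_spec.atomic
        (Pretype.exists_isRestr e he s hs hLS P').choose_spec hP) P₀ P₁ h) p

/-- `pullback` does not depend on the chosen restriction. -/
theorem GaloisType.pullback_mk {M M' : Type u} [L.Structure M] [L.Structure M']
    {I J : Type u} (e : M' ↪[L] M) (he : K.IsEmb e) (s : J → I) (hs : Function.Injective s)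
    (hLS : K.LS ≤ #M') (P : Pretype K M I) (Q : Pretype K M' J) (h : P.IsRestr e s Q) :
    GaloisType.pullback e he s hs hLS (Quotient.mk (Pretype.setoid K M I) P) =
      Quotient.mk (Pretype.setoid K M' J) Q :=
  Quotient.sound (s := Pretype.setoid K M' J) (.single
    ((Pretype.exists_isRestr e he s hs hLS P).choose_spec.atomic h (Pretype.Atomic.refl P)))

/-- The restriction `p ↾ S` of `p ∈ S^I(M)` to a model `S ≺_K M` with `‖S‖ ≥ LS(K)`. -/
noncomputable def GaloisType.restrict {M : Type u} [L.Structure M] {I : Type u}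
    (p : GaloisType K M I) (S : L.Substructure M) (hS : K.Strong S) (hLS : K.LS ≤ #S) :
    GaloisType K S I :=
  p.pullback S.subtype (isEmb_subtype hS) id Function.injective_id hLS

/-- The restriction `p^J` of `p ∈ S^I(M)`, where `M ∈ K` and `‖M‖ ≥ LS(K)`, to the subsequence
indexed by `J ⊆ I`. -/
noncomputable def GaloisType.restrictIndex {M : Type u} [L.Structure M] {I : Type u}
    (p : GaloisType K M I) (hM : K.Mem M) (hLS : K.LS ≤ #M) (J : Set I) : GaloisType K M J :=
  p.pullback (Embedding.refl L M) (isEmb_refl hM) Subtype.val Subtype.val_injective hLS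

variable (K)

/-! ### Tameness and type shortness -/

/-- `K` is `(< χ, μ)`-tame for types of length `I` (where `LS(K) < χ ≤ μ`): distinct types over a
model of size `μ` have distinct restrictions to some strong submodel of size `< χ`. Only submodels
of size `≥ LS(K)` are taken into account, since types are considered over such models only. -/
def TameFor (χ μ : Cardinal.{u}) (I : Type u) : Prop :=
  ∀ (M : Type u) [L.Structure M], K.Mem M → #M = μ → ∀ p q : GaloisType K M I, p ≠ q →
    ∃ (S : L.Substructure M) (hS : K.Strong S) (hLS : K.LS ≤ #S), #S < χ ∧
      p.restrict S hS hLS ≠ q.restrict S hS hLS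

/-- `K` is fully `(< χ, μ)`-tame. -/
def FullyTame (χ μ : Cardinal.{u}) : Prop :=
  ∀ I : Type u, K.TameFor χ μ I

/-- `K` is `(< χ, μ)`-type short over models of size `θ` (where `θ ≥ LS(K)`): distinct types of
length `μ` over such a model have distinct restrictions to some subsequence of length `< χ`. -/
def TypeShortOver (χ μ θ : Cardinal.{u}) : Prop :=
  ∀ (M : Type u) [L.Structure M] (hM : K.Mem M) (hLS : K.LS ≤ #M), #M = θ →
    ∀ I : Type u, #I = μ → ∀ p q : GaloisType K M I, p ≠ q →
      ∃ J : Set I, #J < χ ∧ p.restrictIndex hM hLS J ≠ q.restrictIndex hM hLS J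

/-- `K` is fully `(< χ, μ)`-type short. -/
def FullyTypeShort (χ μ : Cardinal.{u}) : Prop :=
  ∀ θ : Cardinal.{u}, K.TypeShortOver χ μ θ

end AEC

/-! ### The logic `L_{κ,ω}` -/

/-- Formulas of `L_{κ,ω}` with free variables among `x_0, …, x_{n-1}`. Conjunctions are indexed by
sets of size `< κ`, taken without loss of generality to be subsets of a fixed set of size `κ`. -/
inductive InfFormula (L : FirstOrder.Language.{u, u}) (κ : Cardinal.{u}) : ℕ → Type u
  | equal {n : ℕ} (t₁ t₂ : L.Term (Fin n)) : InfFormula L κ n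
  | rel {n k : ℕ} (R : L.Relations k) (t : Fin k → L.Term (Fin n)) : InfFormula L κ n
  | neg {n : ℕ} (φ : InfFormula L κ n) : InfFormula L κ n
  | and {n : ℕ} (φ ψ : InfFormula L κ n) : InfFormula L κ n
  | conj {n : ℕ} (s : Set κ.out) (hs : #s < κ) (φ : s → InfFormula L κ n) : InfFormula L κ n
  | all {n : ℕ} (φ : InfFormula L κ (n + 1)) : InfFormula L κ n

namespace InfFormula

variable {L : FirstOrder.Language.{u, u}} {κ : Cardinal.{u}}

/-- Satisfaction. -/
def Realize {M : Type u} [L.Structure M] : {n : ℕ} → InfFormula L κ n → (Fin n → M) → Prop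
  | _, equal t₁ t₂, v => t₁.realize v = t₂.realize v
  | _, rel R t, v => Structure.RelMap R fun i => (t i).realize v
  | _, neg φ, v => ¬ φ.Realize v
  | _, and φ ψ, v => φ.Realize v ∧ ψ.Realize v
  | _, conj _ _ φ, v => ∀ i, (φ i).Realize v
  | _, all φ, v => ∀ x, φ.Realize (Fin.snoc (α := fun _ => M) v x)

/-- A substitution, extended by the identity on one further variable. -/
def liftSubst {n m : ℕ} (σ : Fin n → L.Term (Fin m)) : Fin (n + 1) → L.Term (Fin (m + 1)) :=
  Fin.snoc (α := fun _ => L.Term (Fin (m + 1))) (fun i => (σ i).relabel Fin.castSucc)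
    (Term.var (Fin.last m))

/-- Capture-avoiding substitution of terms for the free variables. -/
def subst : {n : ℕ} → InfFormula L κ n → {m : ℕ} → (Fin n → L.Term (Fin m)) → InfFormula L κ m
  | _, equal t₁ t₂, _, σ => equal (t₁.subst σ) (t₂.subst σ)
  | _, rel R t, _, σ => rel R fun i => (t i).subst σ
  | _, neg φ, _, σ => neg (φ.subst σ)
  | _, and φ ψ, _, σ => and (φ.subst σ) (ψ.subst σ)
  | _, conj s hs φ, _, σ => conj s hs fun i => (φ i).subst σ
  | _, all φ, _, σ => all (φ.subst (liftSubst σ))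

end InfFormula

/-- A fragment of `L_{κ,ω}`: a set of formulas that contains the atomic formulas and is closed under
the finitary connectives and quantifiers, substitution of terms, and subformulas. -/
structure IsFragment {L : FirstOrder.Language.{u, u}} {κ : Cardinal.{u}} (F : ∀ n, Set (InfFormula L κ n)) :
    Prop where
  equal : ∀ {n : ℕ} (t₁ t₂ : L.Term (Fin n)), .equal t₁ t₂ ∈ F n
  rel : ∀ {n k : ℕ} (R : L.Relations k) (t : Fin k → L.Term (Fin n)), .rel R t ∈ F n
  neg : ∀ {n : ℕ} (φ : InfFormula L κ n), .neg φ ∈ F n ↔ φ ∈ F n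
  and : ∀ {n : ℕ} (φ ψ : InfFormula L κ n), .and φ ψ ∈ F n ↔ φ ∈ F n ∧ ψ ∈ F n
  all : ∀ {n : ℕ} (φ : InfFormula L κ (n + 1)), .all φ ∈ F n ↔ φ ∈ F (n + 1)
  conj : ∀ {n : ℕ} (s : Set κ.out) (hs : #s < κ) (φ : s → InfFormula L κ n),
    .conj s hs φ ∈ F n → ∀ i, φ i ∈ F n
  subst : ∀ {n m : ℕ} (φ : InfFormula L κ n) (σ : Fin n → L.Term (Fin m)),
    φ ∈ F n → φ.subst σ ∈ F m

namespace AEC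

variable {L : FirstOrder.Language.{u, u}} (K : AEC L)

/-- `M` is a (nonempty) model of the `L_{κ,ω}`-theory `T`. -/
def IsModelOf {κ : Cardinal.{u}} (T : Set (InfFormula L κ 0)) (M : Type u) [L.Structure M] : Prop :=
  Nonempty M ∧ ∀ φ ∈ T, φ.Realize (M := M) Fin.elim0

/-- `K = (Mod T, ≺_F)`: `K` is the class of models of `T`, and `S ≺_K N` iff `S` and `N` are models
of `T` and `S` is an `F`-elementary substructure of `N`. -/
def IsModClass {κ : Cardinal.{u}} (T : Set (InfFormula L κ 0)) (F : ∀ n, Set (InfFormula L κ n)) :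
    Prop :=
  (∀ (M : Type u) [L.Structure M], K.Mem M ↔ IsModelOf T M) ∧
  ∀ (N : Type u) [L.Structure N] (S : L.Substructure N), K.Strong S ↔
    IsModelOf T S ∧ IsModelOf T N ∧ ∀ (n : ℕ), ∀ φ ∈ F n, ∀ v : Fin n → S,
      φ.Realize v ↔ φ.Realize (fun i => (v i : N))

/-- `K` is essentially below `κ`: either `LS(K) < κ`, or `K = (Mod T, ≺_F)` for a theory `T` in a
fragment `F` of `L_{κ,ω}`. -/
def EssentiallyBelow (κ : Cardinal.{u}) : Prop :=
  K.LS < κ ∨ ∃ (T : Set (InfFormula L κ 0)) (F : ∀ n, Set (InfFormula L κ n)),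
    IsFragment F ∧ T ⊆ F 0 ∧ K.IsModClass T F

end AEC

/-- `κ` is measurable: it is uncountable and there is a nonprincipal `κ`-complete ultrafilter on a
set of size `κ`. -/
def IsMeasurableCardinal (κ : Cardinal.{u}) : Prop :=
  ℵ₀ < κ ∧ ∃ U : Ultrafilter κ.out, CardinalInterFilter (U : Filter κ.out) κ ∧ ∀ a, {a} ∉ U

namespace AEC

variable {L : FirstOrder.Language.{u, u}} {K : AEC L}

/-! ### Strong embeddings -/

/-! Fix a nonprincipal `κ`-complete ultrafilter `U` on `κ`. The class `K` is closed under
ultraproducts modulo `U`, of models and of `K`-embeddings, and diagonal embeddings are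
`K`-embeddings (`UltraClosed`). For a theory in `L_{κ,ω}` this is Łoś's theorem. If `LS(K) < κ`,
write each factor as a directed union of strong submodels of size at most `LS(K)`. By
`κ`-completeness an ultraproduct of such small submodels is isomorphic to almost all of them
(`Le.ultraproduct`), so the ultraproduct of the factors is a `≺_K`-directed union of small models,
and an AEC is closed under such unions (`Le.finsetUnion`).

Let `p`, `q` be types over `M` that agree on all small pieces. As `cf λ = κ`, there are small pieces
indexed by `i < κ` such that each element of `M` (or of `I`) lies in almost all of them
(`exists_cover_of_cof_eq`). For each `i`, equality of the restrictions is witnessed by a finite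
chain of atomic equivalences. Since `U` is countably complete, almost all chains have one common
length, so their ultraproduct is again a finite chain.

The diagonal of `M` factors through the ultraproduct of the pieces, so the ultraproduct of each
link, cut down by Löwenheim-Skolem, is a pretype over `M`. The first and last links embed into
ultrapowers of the ambient models of `p` and `q`, hence are atomically equivalent to the given
representatives. This proves `p = q` without amalgamation (`GaloisType.eq_of_pullback_eq`). -/

theorem IsEmb.mem_left {M N : Type u} [L.Structure M] [L.Structure N] {f : M ↪[L] N}
    (hf : K.IsEmb f) : K.Mem M :=
  K.mem_of_equiv f.equivRange.symm (K.mem_of_strong _ hf).1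

theorem isEmb_of_surjective {M N : Type u} [L.Structure M] [L.Structure N] {f : M ↪[L] N}
    (hf : Function.Surjective f) (hN : K.Mem N) : K.IsEmb f := by
  unfold IsEmb
  rw [Hom.range_eq_top.2 hf]
  exact K.strong_top N hN

theorem IsEmb.strong_map {M N : Type u} [L.Structure M] [L.Structure N] {f : M ↪[L] N}
    (hf : K.IsEmb f) {S : L.Substructure M} (hS : K.Strong S) : K.Strong (S.map f.toHom) := by
  have h := hf.comp (isEmb_subtype hS)
  unfold IsEmb at h
  convert h using 1
  ext x
  constructor
  · rintro ⟨y, hy, rfl⟩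
    exact ⟨⟨y, hy⟩, rfl⟩
  · rintro ⟨y, rfl⟩
    exact ⟨y, y.2, rfl⟩

/-- If `g ∘ h = f` with `g` and `f` strong, then `h` exists and is strong as soon as the range of
`f` is contained in the range of `g`. -/
theorem IsEmb.exists_factor {M N P : Type u} [L.Structure M] [L.Structure N] [L.Structure P]
    {g : N ↪[L] P} {f : M ↪[L] P} (hg : K.IsEmb g) (hf : K.IsEmb f)
    (h : ∀ x, ∃ y, g y = f x) : ∃ k : M ↪[L] N, K.IsEmb k ∧ ∀ x, g (k x) = f x := by
  have h' : ∀ x, f x ∈ g.toHom.range := h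
  refine ⟨g.equivRange.symm.toEmbedding.comp (Embedding.codRestrict _ f h'), ?_, fun x => ?_⟩
  · exact (isEmb_of_surjective (f := g.equivRange.symm.toEmbedding)
      g.equivRange.symm.surjective hg.mem_left).comp (hf.codRestrict hg h')
  · exact (g.equivRange_apply (g.equivRange.symm (Embedding.codRestrict _ f h' x))).symm.trans
      (congrArg Subtype.val (g.equivRange.apply_symm_apply (Embedding.codRestrict _ f h' x)))

/-! ### The relation `S ≺_K T` between substructures of an arbitrary structure -/

variable (K)

/-- `S ≺_K T`, for substructures `S`, `T` of a structure that need not be in `K`. -/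
def Le {N : Type u} [L.Structure N] (S T : L.Substructure N) : Prop :=
  S ≤ T ∧ K.Strong (S.comap T.subtype.toHom)

variable {K}

section Le

variable {N : Type u} [L.Structure N] {S T V : L.Substructure N}

/-- Translating to embeddings lets transitivity and changes of ambient structure follow from
`IsEmb.comp`. -/
theorem le_iff_isEmb (h : S ≤ T) :
    K.Le S T ↔ K.IsEmb (Embedding.codRestrict T S.subtype fun x => h x.2) := by
  unfold Le IsEmb
  rw [and_iff_right h, iff_iff_eq]
  congr 1
  ext ⟨y, hy⟩
  constructor
  · intro hx
    exact ⟨⟨y, hx⟩, rfl⟩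
  · rintro ⟨x, hx⟩
    have := congrArg Subtype.val hx
    change (x : N) = y at this
    change y ∈ S
    exact this ▸ x.2

theorem Le.mem_right (h : K.Le S T) : K.Mem T := (K.mem_of_strong _ h.2).2

theorem Le.mem_left (h : K.Le S T) : K.Mem S := ((le_iff_isEmb h.1).1 h).mem_left

theorem Le.trans (h : K.Le S T) (h' : K.Le T V) : K.Le S V :=
  (le_iff_isEmb (h.1.trans h'.1)).2
    (((le_iff_isEmb h'.1).1 h').comp ((le_iff_isEmb h.1).1 h))

theorem Le.of_strong (h : S ≤ T) (hS : K.Strong S) (hT : K.Strong T) : K.Le S T :=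
  ⟨h, K.coherence S T h hS hT⟩

theorem Le.strong_of_top (h : K.Le S ⊤) : K.Strong S := by
  have h1 := isEmb_of_surjective (f := (Substructure.topEquiv (L := L) (M := N)).toEmbedding)
    Substructure.topEquiv.surjective (K.mem_of_equiv Substructure.topEquiv h.mem_right)
  have h2 := h1.comp ((le_iff_isEmb h.1).1 h)
  unfold IsEmb at h2
  convert h2 using 1
  ext x
  constructor
  · intro hx
    exact ⟨⟨x, hx⟩, rfl⟩
  · rintro ⟨y, rfl⟩
    exact y.2

theorem mem_comap_subtype (h : S ≤ V) (hS : K.Mem S) : K.Mem (S.comap V.subtype.toHom) := by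
  let f : S.comap V.subtype.toHom ↪[L] S :=
    Embedding.codRestrict S (V.subtype.comp (S.comap V.subtype.toHom).subtype) fun x => x.2
  have hf : Function.Surjective f := fun x => ⟨⟨⟨x, h x.2⟩, x.2⟩, rfl⟩
  exact (isEmb_of_surjective hf hS).mem_left

theorem Le.comap (h : K.Le S T) (hV : T ≤ V) :
    K.Le (S.comap V.subtype.toHom) (T.comap V.subtype.toHom) := by
  have hle : S.comap V.subtype.toHom ≤ T.comap V.subtype.toHom := fun x hx => h.1 hx
  let f : S.comap V.subtype.toHom ↪[L] S :=
    Embedding.codRestrict S (V.subtype.comp (S.comap V.subtype.toHom).subtype) fun x => x.2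
  have hf : Function.Surjective f := fun x => ⟨⟨⟨x, hV (h.1 x.2)⟩, x.2⟩, rfl⟩
  let g : T ↪[L] T.comap V.subtype.toHom :=
    Embedding.codRestrict _ (Embedding.codRestrict V T.subtype fun x => hV x.2) fun x => x.2
  have hg : Function.Surjective g := fun x => ⟨⟨x, x.2⟩, rfl⟩
  refine (le_iff_isEmb hle).2 ?_
  exact (isEmb_of_surjective hg (mem_comap_subtype hV h.mem_right)).comp
    (((le_iff_isEmb h.1).1 h).comp (isEmb_of_surjective hf h.mem_left))

theorem comap_subtype_iSup {ι : Type u} [LinearOrder ι] [Nonempty ι] {S : ι → L.Substructure N}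
    (hS : Monotone S) :
    (⨆ i, S i).comap V.subtype.toHom = ⨆ i, (S i).comap V.subtype.toHom := by
  have hd : Directed (· ≤ ·) fun i => (S i).comap V.subtype.toHom :=
    Monotone.directed_le fun i j h x hx => hS h hx
  ext x
  rw [Substructure.mem_comap, Substructure.mem_iSup_of_directed hS.directed_le,
    Substructure.mem_iSup_of_directed hd]
  rfl

theorem comap_subtype_iSup_Iio {ι : Type u} [LinearOrder ι] {S : ι → L.Substructure N}
    (hS : Monotone S) {i : ι} (hi : Order.IsSuccLimit i) (h : S i = ⨆ j : Set.Iio i, S j) :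
    (S i).comap V.subtype.toHom = ⨆ j : Set.Iio i, (S j).comap V.subtype.toHom := by
  obtain ⟨j, hj⟩ := not_isMin_iff.1 hi.1
  have : Nonempty (Set.Iio i) := ⟨⟨j, hj⟩⟩
  rw [h]
  exact comap_subtype_iSup (S := fun j : Set.Iio i => S j) fun a b hab => hS hab

variable {ι : Type u} [LinearOrder ι] [WellFoundedLT ι] [Nonempty ι]

/-- The axiom `union_chain` concerns chains that exhaust their ambient structure, so it is applied
inside the union itself. -/
theorem Le.le_iSup_chain {S : ι → L.Substructure N} (h : ∀ i j, i ≤ j → K.Le (S i) (S j))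
    (hlim : ∀ i, Order.IsSuccLimit i → S i = ⨆ j : Set.Iio i, S j) (i : ι) :
    K.Le (S i) (⨆ i, S i) := by
  have hmono : Monotone S := fun i j hij => (h i j hij).1
  have hle : ∀ i, S i ≤ ⨆ i, S i := le_iSup S
  refine ⟨hle i, ?_⟩
  refine (K.union_chain (N := ↥(⨆ i, S i))
    (fun i => (S i).comap (⨆ i, S i).subtype.toHom) ?_ ?_ ?_ ?_).2 i
  · exact fun i => mem_comap_subtype (hle i) (h i i le_rfl).mem_left
  · exact fun i j hij => (h i j hij).comap (hle j)
  · exact fun i hi => comap_subtype_iSup_Iio hmono hi (hlim i hi)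
  · rw [← comap_subtype_iSup hmono]
    ext x
    exact ⟨fun _ => trivial, fun _ => x.2⟩

/-- This is `union_chain_strong` applied inside `T`. -/
theorem Le.iSup_chain_le {S : ι → L.Substructure N} (h : ∀ i j, i ≤ j → K.Le (S i) (S j))
    (hlim : ∀ i, Order.IsSuccLimit i → S i = ⨆ j : Set.Iio i, S j) (hT : ∀ i, K.Le (S i) T) :
    K.Le (⨆ i, S i) T := by
  have hmono : Monotone S := fun i j hij => (h i j hij).1
  refine ⟨iSup_le fun i => (hT i).1, ?_⟩
  rw [comap_subtype_iSup hmono]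
  refine K.union_chain_strong _ (fun i => (hT i).2) ?_ ?_
  · exact fun i j hij => (h i j hij).comap (hT j).1
  · exact fun i hi => comap_subtype_iSup_Iio hmono hi (hlim i hi)

end Le

/-! ### Unions of directed systems indexed by finite sets -/

section FinsetSystem

variable {N X : Type u} [L.Structure N] (S : Finset X → L.Substructure N)

/-- The union of the members of a system of substructures that are indexed by the finite subsets
of `Y`. -/
def finsetUnion (Y : Set X) : L.Substructure N :=
  ⨆ A : {A : Finset X // (A : Set X) ⊆ Y}, S A

variable {S}

theorem mem_finsetUnion (hS : Monotone S) {Y : Set X} {x : N} :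
    x ∈ finsetUnion S Y ↔ ∃ A : Finset X, (A : Set X) ⊆ Y ∧ x ∈ S A := by
  classical
  have : Nonempty {A : Finset X // (A : Set X) ⊆ Y} := ⟨⟨∅, by simp⟩⟩
  have hd : Directed (· ≤ ·) fun A : {A : Finset X // (A : Set X) ⊆ Y} => S A := by
    rintro ⟨A, hA⟩ ⟨B, hB⟩
    exact ⟨⟨A ∪ B, by simp [hA, hB]⟩, hS Finset.subset_union_left, hS Finset.subset_union_right⟩
  rw [finsetUnion, Substructure.mem_iSup_of_directed hd]
  simp

theorem finsetUnion_coe (hS : Monotone S) (A : Finset X) : finsetUnion S (A : Set X) = S A := by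
  ext x
  rw [mem_finsetUnion hS]
  exact ⟨fun ⟨B, hB, hx⟩ => hS (Finset.coe_subset.1 hB) hx, fun hx => ⟨A, le_rfl, hx⟩⟩

theorem finsetUnion_mono {Y Z : Set X} (h : Y ⊆ Z) : finsetUnion S Y ≤ finsetUnion S Z :=
  iSup_le fun A => le_iSup (fun A : {A : Finset X // (A : Set X) ⊆ Z} => S A)
    ⟨A.1, A.2.trans h⟩

theorem finsetUnion_iUnion {ι : Type u} [LinearOrder ι] [Nonempty ι]
    {Y : ι → Set X} (hY : Monotone Y) :
    finsetUnion S (⋃ i, Y i) = ⨆ i, finsetUnion S (Y i) := by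
  refine le_antisymm (iSup_le ?_) (iSup_le fun i => finsetUnion_mono (Set.subset_iUnion Y i))
  rintro ⟨A, hA⟩
  obtain ⟨i, hi⟩ := hY.directed_le.exists_mem_subset_of_finset_subset_biUnion hA
  exact le_trans (le_iSup (fun A : {A : Finset X // (A : Set X) ⊆ Y i} => S A) ⟨A, hi⟩)
    (le_iSup (fun i => finsetUnion S (Y i)) i)

/-- A `≺_K`-directed system indexed by finite sets stays `≺_K`-increasing when it is extended to
arbitrary sets by unions. -/
theorem Le.finsetUnion (h : ∀ A B : Finset X, A ⊆ B → K.Le (S A) (S B)) {Y Z : Set X}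
    (hYZ : Y ⊆ Z) : K.Le (finsetUnion S Y) (finsetUnion S Z) := by
  have hS : Monotone S := fun A B hAB => (h A B hAB).1
  induction hc : #Z using WellFoundedLT.induction generalizing Y Z with
  | ind c ih =>
  subst hc
  rcases lt_or_ge #Z ℵ₀ with hfin | hinf
  · have hZ : Z.Finite := lt_aleph0_iff_set_finite.1 hfin
    lift Z to Finset X using hZ
    lift Y to Finset X using Z.finite_toSet.subset hYZ
    rw [finsetUnion_coe hS, finsetUnion_coe hS]
    exact h _ _ (Finset.coe_subset.1 hYZ)
  -- Well-order `Z` in type `|Z|`: its proper initial segments `W i` are smaller than `Z`, so the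
  -- induction hypothesis applies to subsets of them.
  · let ι := (#Z).ord.ToType
    have : Nonempty ι := by
      rw [← mk_ne_zero_iff, mk_toType, card_ord]
      exact (aleph0_pos.trans_le hinf).ne'
    have : NoMaxOrder ι := Cardinal.noMaxOrder hinf
    obtain ⟨e⟩ : Nonempty (Z ≃ ι) := Cardinal.eq.1 (by rw [mk_toType, card_ord])
    let W : ι → Set X := fun i => {x | ∃ hx : x ∈ Z, e ⟨x, hx⟩ < i}
    have hWmono : Monotone W := fun i j hij x ⟨hx, hlt⟩ => ⟨hx, hlt.trans_le hij⟩
    have hWcard : ∀ i, #(W i) < #Z := by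
      intro i
      have h1 : #(Set.Iio i) < #Z := 
        (Cardinal.mk_Iio_lt i (by simp [ι])).trans_eq (by simp [ι])
      refine lt_of_le_of_lt ?_ h1
      refine mk_le_of_injective (f := fun x : W i => (⟨e ⟨x, x.2.1⟩, x.2.2⟩ : Set.Iio i)) ?_
      intro x y hxy
      have h2 := e.injective (congrArg Subtype.val hxy)
      exact Subtype.ext (Subtype.mk.inj h2)
    have hWZ : ⋃ i, W i = Z := by
      ext x
      simp only [Set.mem_iUnion]
      refine ⟨fun ⟨i, hx, _⟩ => hx, fun hx => ?_⟩
      obtain ⟨j, hj⟩ := exists_gt (e ⟨x, hx⟩)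
      exact ⟨j, hx, hj⟩
    have hWlim : ∀ i, Order.IsSuccLimit i → W i = ⋃ j : Set.Iio i, W j := by
      intro i hi
      ext x
      simp only [Set.mem_iUnion]
      constructor
      · rintro ⟨hx, hlt⟩
        obtain ⟨j, hj, hji⟩ := (hi.isSuccPrelimit.lt_iff_exists_lt).1 hlt
        exact ⟨⟨j, hj⟩, hx, hji⟩
      · rintro ⟨j, hx⟩
        exact hWmono (le_of_lt j.2) hx
    -- the chain of the sets `Y' ∩ W i`, for `Y' ⊆ Z`
    have key : ∀ Y' : Set X, Y' ⊆ Z →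
        (∀ i j, i ≤ j → K.Le (AEC.finsetUnion S (Y' ∩ W i)) (AEC.finsetUnion S (Y' ∩ W j))) ∧
        (∀ i, Order.IsSuccLimit i → AEC.finsetUnion S (Y' ∩ W i) =
          ⨆ j : Set.Iio i, AEC.finsetUnion S (Y' ∩ W j)) ∧
        AEC.finsetUnion S Y' = ⨆ i, AEC.finsetUnion S (Y' ∩ W i) := by
      intro Y' hY'
      refine ⟨fun i j hij => ?_, fun i hi => ?_, ?_⟩
      · exact ih _ ((mk_le_mk_of_subset Set.inter_subset_right).trans_lt (hWcard j))
          (Set.inter_subset_inter_right _ (hWmono hij)) rfl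
      · obtain ⟨j, hj⟩ := not_isMin_iff.1 hi.1
        have : Nonempty (Set.Iio i) := ⟨⟨j, hj⟩⟩
        rw [hWlim i hi, Set.inter_iUnion]
        exact finsetUnion_iUnion (Y := fun j : Set.Iio i => Y' ∩ W j)
          fun a b hab => Set.inter_subset_inter_right _ (hWmono hab)
      · rw [← finsetUnion_iUnion (Y := fun i => Y' ∩ W i)
          fun a b hab => Set.inter_subset_inter_right _ (hWmono hab), ← Set.inter_iUnion, hWZ,
          Set.inter_eq_left.2 hY']
    obtain ⟨hZ1, hZ2, hZ3⟩ := key Z le_rfl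
    obtain ⟨hY1, hY2, hY3⟩ := key Y hYZ
    rw [hY3]
    refine Le.iSup_chain_le hY1 hY2 fun i => ?_
    -- The union over `Y ∩ W i` is strong in the one over `Z ∩ W i` by induction, and the latter is
    -- a member of the chain with union `Z`.
    refine Le.trans (ih _ ((mk_le_mk_of_subset Set.inter_subset_right).trans_lt (hWcard i))
      (Set.inter_subset_inter_left _ hYZ) rfl) ?_
    rw [hZ3]
    exact Le.le_iSup_chain hZ1 hZ2 i

end FinsetSystem

end AEC

/-! ### Ultraproducts of structures -/

section Ultraproduct

open Filter

variable {L : FirstOrder.Language.{u, u}} {α : Type u} (U : Ultrafilter α)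

/-- The ultraproduct of the `M i`. -/
abbrev UProd (M : α → Type u) : Type u := (U : Filter α).Product M

namespace UProd

variable {M N : α → Type u}

/-- The class of a choice function. -/
def mk (x : ∀ i, M i) : UProd U M := (x : (U : Filter α).Product M)

variable {U}

theorem mk_eq_mk {x y : ∀ i, M i} : mk U x = mk U y ↔ ∀ᶠ i in U, x i = y i :=
  Quotient.eq''

theorem exists_mk (p : UProd U M) : ∃ x, mk U x = p := Quotient.exists_rep p

/-- A representative. -/
noncomputable def out (p : UProd U M) : ∀ i, M i := (exists_mk p).choose

@[simp] theorem mk_out (p : UProd U M) : mk U (out p) = p := (exists_mk p).choose_spec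

theorem out_mk (x : ∀ i, M i) : ∀ᶠ i in U, out (mk U x) i = x i := mk_eq_mk.1 (mk_out _)

variable [∀ i, L.Structure (M i)] [∀ i, L.Structure (N i)]

theorem funMap_mk {n : ℕ} (f : L.Functions n) (x : Fin n → ∀ i, M i) :
    Structure.funMap f (fun k => mk U (x k)) = mk U fun i => Structure.funMap f fun k => x k i :=
  Ultraproduct.funMap_cast f x

theorem relMap_mk {n : ℕ} (r : L.Relations n) (x : Fin n → ∀ i, M i) :
    Structure.RelMap r (fun k => mk U (x k)) ↔ ∀ᶠ i in U, Structure.RelMap r fun k => x k i :=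
  @relMap_quotient_mk' L _ ((U : Filter α).productSetoid M)
    (Ultraproduct.setoidPrestructure M U) _ r x

theorem realize_mk {n : ℕ} (t : L.Term (Fin n)) (x : Fin n → ∀ i, M i) :
    t.realize (fun k => mk U (x k)) = mk U fun i => t.realize fun k => x k i :=
  Ultraproduct.term_realize_cast x t

theorem exists_mk_fun {n : ℕ} (v : Fin n → UProd U M) :
    ∃ x : Fin n → ∀ i, M i, v = fun k => mk U (x k) :=
  ⟨fun k => out (v k), funext fun k => (mk_out (v k)).symm⟩

variable (U)

/-- The ultraproduct of a family of embeddings. -/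
def map (f : ∀ i, M i ↪[L] N i) : UProd U M ↪[L] UProd U N where
  toFun := Quotient.map' (fun x i => f i (x i)) fun x y (h : ∀ᶠ i in U, x i = y i) =>
    h.mono fun i hi => congrArg (f i) hi
  inj' := by
    intro _ _ h
    rename_i p q
    obtain ⟨x, rfl⟩ := exists_mk p
    obtain ⟨y, rfl⟩ := exists_mk q
    have h' : ∀ᶠ i in U, f i (x i) = f i (y i) := mk_eq_mk.1 h
    exact mk_eq_mk.2 (h'.mono fun i hi => (f i).injective hi)
  map_fun' := by
    intro n F v
    obtain ⟨x, rfl⟩ := exists_mk_fun v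
    rw [funMap_mk]
    refine Eq.trans ?_ (funMap_mk F fun k i => f i (x k i)).symm
    exact mk_eq_mk.2 (.of_forall fun i => (f i).map_fun F _)
  map_rel' := by
    intro n r v
    obtain ⟨x, rfl⟩ := exists_mk_fun v
    rw [relMap_mk]
    refine (relMap_mk r fun k i => f i (x k i)).trans ?_
    exact eventually_congr (.of_forall fun i => (f i).map_rel r _)

theorem map_mk (f : ∀ i, M i ↪[L] N i) (x : ∀ i, M i) :
    map U f (mk U x) = mk U fun i => f i (x i) := rfl

/-- The diagonal embedding in an ultrapower. -/
def diag (P : Type u) [L.Structure P] : P ↪[L] UProd U fun _ => P where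
  toFun p := mk U fun _ => p
  inj' _ _ h := eventually_const.1 (mk_eq_mk.1 h)
  map_fun' F v := (funMap_mk F fun k _ => v k).symm
  map_rel' r v := (relMap_mk r fun k _ => v k).trans eventually_const

theorem diag_apply {P : Type u} [L.Structure P] (p : P) :
    diag (L := L) U P p = mk U fun _ => p := rfl

variable {U}

/-- The ultraproduct of a family of substructures, as a substructure of the ultraproduct. -/
def sub (T : ∀ i, L.Substructure (M i)) : L.Substructure (UProd U M) where
  carrier := {p | ∀ᶠ i in U, out p i ∈ T i}
  fun_mem {n} F v hv := by
    have h1 : v = fun k => mk U (out (v k)) := funext fun k => (mk_out (v k)).symm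
    have h2 : Structure.funMap F v = mk U fun i => Structure.funMap F fun k => out (v k) i := by
      conv_lhs => rw [h1]
      exact funMap_mk F _
    change ∀ᶠ i in U, out (Structure.funMap F v) i ∈ T i
    rw [h2]
    filter_upwards [out_mk (U := U) fun i => Structure.funMap F fun k => out (v k) i,
      eventually_all.2 hv] with i hi hi'
    rw [hi]
    exact (T i).fun_mem F _ hi'

theorem mem_sub {T : ∀ i, L.Substructure (M i)} {p : UProd U M} :
    p ∈ sub (U := U) T ↔ ∀ᶠ i in U, out p i ∈ T i := Iff.rfl

theorem mk_mem_sub {T : ∀ i, L.Substructure (M i)} {x : ∀ i, M i} :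
    mk U x ∈ sub (U := U) T ↔ ∀ᶠ i in U, x i ∈ T i := by
  rw [mem_sub]
  exact eventually_congr ((out_mk x).mono fun i hi => by rw [hi])

theorem sub_mono {T T' : ∀ i, L.Substructure (M i)} (h : ∀ᶠ i in U, T i ≤ T' i) :
    sub (U := U) T ≤ sub T' := fun _ hp =>
  (h.and (mem_sub.1 hp)).mono fun _ hi => hi.1 hi.2

theorem map_range [∀ i, Nonempty (M i)] (f : ∀ i, M i ↪[L] N i) :
    (map U f).toHom.range = sub fun i => (f i).toHom.range := by
  ext p
  constructor
  · rintro ⟨q, rfl⟩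
    obtain ⟨x, rfl⟩ := exists_mk q
    exact mk_mem_sub.2 (.of_forall fun i => ⟨x i, rfl⟩)
  · intro hp
    -- Off the large set where `out p i` is in the range, `invFun` gives an irrelevant value; this
    -- is where the factors must be nonempty.
    refine ⟨mk U fun i => Function.invFun (f i) (out p i), ?_⟩
    refine Eq.trans (mk_eq_mk.2 ?_) (mk_out p)
    exact (mem_sub.1 hp).mono fun i hi => Function.invFun_eq hi

end UProd

/-- Almost every index decides `p` as `U` does. With `κ`-completeness this settles fewer than `κ`
statements at a single index. -/
theorem Ultrafilter.eventually_iff_eventually (p : α → Prop) :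
    ∀ᶠ i in U, (p i ↔ ∀ᶠ j in U, p j) := by
  by_cases h : ∀ᶠ j in U, p j
  · exact h.mono fun i hi => iff_of_true hi h
  · exact (Ultrafilter.eventually_not.2 h).mono fun i hi => iff_of_false hi h

/-- The fibres of `g` are fewer than `κ` sets covering `α`, so they cannot all be null. -/
theorem Ultrafilter.exists_eventually_eq {κ : Cardinal.{u}} [CardinalInterFilter (U : Filter α) κ]
    {J : Type u} (hJ : #J < κ) (g : α → J) : ∃ j, ∀ᶠ i in U, g i = j := by
  by_contra h
  rw [not_exists] at h
  have h1 : ∀ j, ∀ᶠ i in U, g i ≠ j := fun j => Ultrafilter.eventually_not.2 (h j)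
  obtain ⟨i, hi⟩ := ((eventually_cardinal_forall hJ).2 h1).exists
  exact hi _ rfl

/-- `K` is closed under ultraproducts modulo `U`, both of models and of strong embeddings, and
diagonal embeddings are strong. -/
structure AEC.UltraClosed (K : AEC L) : Prop where
  map : ∀ {M N : α → Type u} [∀ i, L.Structure (M i)] [∀ i, L.Structure (N i)]
    (f : ∀ i, M i ↪[L] N i), (∀ i, K.IsEmb (f i)) → K.IsEmb (UProd.map U f)
  diag : ∀ (P : Type u) [L.Structure P], K.Mem P → K.IsEmb (UProd.diag (L := L) U P)

end Ultraproduct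

/-! ### Ultraproducts of small submodels -/

section SmallUltraproduct

open Filter

variable {L : FirstOrder.Language.{u, u}}

/-- With a common index set, comparing an ultraproduct with a factor reduces to comparing the truth
of atomic statements about indices. -/
theorem exists_equiv_of_enumerations {X Y J : Type u} [L.Structure X] [L.Structure Y]
    {s : J → X} {e : J → Y} (hs : Function.Surjective s) (he : Function.Surjective e)
    (heq : ∀ a b, s a = s b ↔ e a = e b)
    (hfun : ∀ (n : ℕ) (F : L.Functions n) (v : Fin n → J) (b : J),
      Structure.funMap F (fun k => s (v k)) = s b ↔ Structure.funMap F (fun k => e (v k)) = e b)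
    (hrel : ∀ (n : ℕ) (r : L.Relations n) (v : Fin n → J),
      Structure.RelMap r (fun k => s (v k)) ↔ Structure.RelMap r (fun k => e (v k))) :
    ∃ φ : X ≃[L] Y, ∀ j, φ (s j) = e j := by
  choose g hg using hs
  choose g' hg' using he
  have h1 : ∀ j, e (g (s j)) = e j := fun j => (heq _ _).1 (hg (s j))
  have h2 : ∀ j, s (g' (e j)) = s j := fun j => (heq _ _).2 (hg' (e j))
  refine ⟨⟨⟨fun x => e (g x), fun y => s (g' y), fun x => ?_, fun y => ?_⟩, ?_, ?_⟩, h1⟩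
  · exact (h2 (g x)).trans (hg x)
  · exact (h1 (g' y)).trans (hg' y)
  · intro n F v
    have h3 : v = fun k => s (g (v k)) := funext fun k => (hg (v k)).symm
    refine ((hfun n F (fun k => g (v k)) (g (Structure.funMap F v))).1 ?_).symm
    rw [hg, ← h3]
  · intro n r v
    have h3 : v = fun k => s (g (v k)) := funext fun k => (hg (v k)).symm
    conv_rhs => rw [h3]
    exact (hrel n r fun k => g (v k)).symm

variable {α : Type u} {U : Ultrafilter α} {κ : Cardinal.{u}}

namespace AEC

variable {K : AEC L}

/-- An ultraproduct of submodels of size at most `c < κ` is isomorphic to almost all of them. -/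
theorem Le.ultraproduct [CardinalInterFilter (U : Filter α) κ] {c : Cardinal.{u}} (hc : ℵ₀ ≤ c)
    (hLc : L.card ≤ c) (hcκ : c < κ) {N : α → Type u} [∀ i, L.Structure (N i)]
    {T T' : ∀ i, L.Substructure (N i)} (hT : ∀ i, K.Le (T i) (T' i)) (hcard : ∀ i, #(T' i) ≤ c) :
    K.Le (UProd.sub (U := U) T) (UProd.sub T') := by
  have hle : UProd.sub (U := U) T ≤ UProd.sub T' := UProd.sub_mono (.of_forall fun i => (hT i).1)
  let J := c.out
  have hJ : #J = c := mk_out c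
  have hJκ : #J < κ := hJ.trans_lt hcκ
  -- Enumerating all `T' i` by one set of size `c` leaves fewer than `κ` atomic statements to
  -- control.
  have henum : ∀ i, ∃ s : J → T' i, Function.Surjective s := by
    intro i
    have : Nonempty (T' i) := K.nonempty_of_mem _ (hT i).mem_right
    obtain ⟨f⟩ : Nonempty (T' i ↪ J) := Cardinal.le_def _ _ |>.1 ((hcard i).trans_eq hJ.symm)
    exact ⟨Function.invFun f, Function.invFun_surjective f.injective⟩
  choose s hs using henum
  let e' : J → UProd U N := fun j => UProd.mk U fun i => (s i j : N i)
  let e : J → UProd.sub (U := U) T' := fun j =>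
    ⟨e' j, UProd.mk_mem_sub.2 (.of_forall fun i => (s i j).2)⟩
  -- An element of the ultraproduct is given by a function from `α` to `J`, which is constant on a
  -- large set.
  have he : Function.Surjective e := by
    rintro ⟨p, hp⟩
    have h1 : ∀ i, ∃ j, UProd.out p i ∈ T' i → (s i j : N i) = UProd.out p i := by
      intro i
      by_cases hi : UProd.out p i ∈ T' i
      · obtain ⟨j, hj⟩ := hs i ⟨_, hi⟩
        exact ⟨j, fun _ => congrArg Subtype.val hj⟩
      · have : Nonempty J := by
          rw [← mk_ne_zero_iff, hJ]
          exact (aleph0_pos.trans_le hc).ne'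
        exact ⟨Classical.arbitrary J, fun h => absurd h hi⟩
    choose g hg using h1
    obtain ⟨j, hj⟩ := Ultrafilter.exists_eventually_eq U hJκ g
    refine ⟨j, Subtype.ext ?_⟩
    refine Eq.trans (UProd.mk_eq_mk.2 ?_) (UProd.mk_out p)
    filter_upwards [hj, UProd.mem_sub.1 hp] with i hi hi'
    rw [← hi]
    exact hg i hi'
  have hvec : ∀ n : ℕ, #(Fin n → J) < κ := by
    intro n
    refine lt_of_le_of_lt ?_ hcκ
    simpa [hJ] using power_nat_le (n := n) hc
  have hnat : #(ULift.{u} ℕ) < κ := by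
    rw [mk_uLift, mk_nat, lift_aleph0]
    exact hc.trans_lt hcκ
  have hF : ∀ n, #(L.Functions n) < κ := fun n => by
    refine lt_of_le_of_lt (le_trans ?_ hLc) hcκ
    exact mk_le_of_injective (f := fun F : L.Functions n => (Sum.inl ⟨n, F⟩ : L.Symbols))
      fun x y h => by simpa using h
  have hR : ∀ n, #(L.Relations n) < κ := fun n => by
    refine lt_of_le_of_lt (le_trans ?_ hLc) hcκ
    exact mk_le_of_injective (f := fun F : L.Relations n => (Sum.inr ⟨n, F⟩ : L.Symbols))
      fun x y h => by simpa using h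
  have heq : ∀ᶠ i in U, ∀ a b, s i a = s i b ↔ e a = e b := by
    refine (eventually_cardinal_forall hJκ).2 fun a => (eventually_cardinal_forall hJκ).2 fun b => ?_
    refine (Ultrafilter.eventually_iff_eventually U fun i => s i a = s i b).mono fun i hi =>
      hi.trans ?_
    rw [Subtype.ext_iff]
    refine Iff.trans ?_ UProd.mk_eq_mk.symm
    simp only [Subtype.ext_iff]
  have hfun : ∀ᶠ i in U, ∀ (n : ULift.{u} ℕ) (F : L.Functions n.down) (v : Fin n.down → J) (b : J),
      Structure.funMap F (fun k => s i (v k)) = s i b ↔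
        Structure.funMap F (fun k => e (v k)) = e b := by
    refine (eventually_cardinal_forall hnat).2 fun n =>
      (eventually_cardinal_forall (hF _)).2 fun F =>
      (eventually_cardinal_forall (hvec _)).2 fun v =>
      (eventually_cardinal_forall hJκ).2 fun b => ?_
    refine (Ultrafilter.eventually_iff_eventually U fun i =>
      Structure.funMap F (fun k => s i (v k)) = s i b).mono fun i hi => hi.trans ?_
    rw [Subtype.ext_iff]
    change _ ↔ Structure.funMap F (fun k => e' (v k)) = e' b
    rw [UProd.funMap_mk]
    refine Iff.trans ?_ UProd.mk_eq_mk.symm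
    simp only [Subtype.ext_iff]
    rfl
  have hrel : ∀ᶠ i in U, ∀ (n : ULift.{u} ℕ) (r : L.Relations n.down) (v : Fin n.down → J),
      Structure.RelMap r (fun k => s i (v k)) ↔ Structure.RelMap r (fun k => e (v k)) := by
    refine (eventually_cardinal_forall hnat).2 fun n =>
      (eventually_cardinal_forall (hR _)).2 fun r =>
      (eventually_cardinal_forall (hvec _)).2 fun v => ?_
    refine (Ultrafilter.eventually_iff_eventually U fun i =>
      Structure.RelMap r (fun k => s i (v k))).mono fun i hi => hi.trans ?_
    change _ ↔ Structure.RelMap r (fun k => e' (v k))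
    exact (UProd.relMap_mk r fun k i => (s i (v k) : N i)).symm
  -- Membership in `T` is treated as one more predicate, so the isomorphism carries the whole pair.
  have hmem : ∀ᶠ i in U, ∀ a, (s i a : N i) ∈ T i ↔ e' a ∈ UProd.sub (U := U) T := by
    refine (eventually_cardinal_forall hJκ).2 fun a => ?_
    exact (Ultrafilter.eventually_iff_eventually U fun i => (s i a : N i) ∈ T i).mono
      fun i hi => hi.trans UProd.mk_mem_sub.symm
  obtain ⟨i, h1, h2, h3, h4⟩ := (heq.and (hfun.and (hrel.and hmem))).exists
  obtain ⟨φ, hφ⟩ := exists_equiv_of_enumerations (L := L) (hs i) he h1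
    (fun n => h2 ⟨n⟩) (fun n => h3 ⟨n⟩)
  refine ⟨hle, ?_⟩
  convert K.strong_of_equiv φ _ (hT i).2 using 1
  ext y
  constructor
  · intro hy
    obtain ⟨j, rfl⟩ := he y
    exact ⟨s i j, (h4 j).2 hy, hφ j⟩
  · rintro ⟨x, hx, rfl⟩
    obtain ⟨j, rfl⟩ := hs i x
    have : φ.toEmbedding.toHom (s i j) = e j := hφ j
    rw [this]
    exact (h4 j).1 hx

/-! ### Systems of small submodels -/

/-- Every model of `K` is the union of a directed system of submodels of size at most `LS(K)`, which
is compatible with a given strong submodel `R`. -/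
theorem exists_finset_system {N : Type u} [L.Structure N] {R : L.Substructure N}
    (hR : K.Strong R) : ∃ S : Finset N → L.Substructure N,
      (∀ A B, A ⊆ B → K.Le (S A) (S B)) ∧ (∀ A, #(S A) ≤ K.LS) ∧ (∀ A : Finset N, (A : Set N) ⊆ S A) ∧
      ∀ A : Finset N, (A : Set N) ⊆ R → S A ≤ R := by
  classical
  obtain ⟨hRm, hN⟩ := K.mem_of_strong R hR
  have hchoice : ∀ X : Set N, ∃ S : L.Substructure N, K.Strong S ∧ X ⊆ S ∧ #S ≤ #X + K.LS ∧
      (X ⊆ R → S ≤ R) := by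
    intro X
    by_cases hX : X ⊆ R
    · obtain ⟨S, hS, hXS, hS'⟩ := K.LS_spec.2 R hRm (Subtype.val ⁻¹' X)
      refine ⟨S.map R.subtype.toHom, (isEmb_subtype hR).strong_map hS,
        fun x hx => ⟨⟨x, hX hx⟩, hXS hx, rfl⟩, ?_, ?_⟩
      · have h1 : #(S.map R.subtype.toHom) = #S :=
          mk_congr (R.subtype.substructureEquivMap S).toEquiv.symm
        rw [h1]
        refine hS'.trans (add_le_add_left ?_ _)
        exact mk_le_of_injective (f := fun x : (Subtype.val ⁻¹' X : Set R) => (⟨x.1.1, x.2⟩ : X))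
          fun x y h => Subtype.ext (Subtype.ext (Subtype.mk.inj h))
      · rintro - x ⟨y, -, rfl⟩
        exact y.2
    · obtain ⟨S, hS, hXS, hS'⟩ := K.LS_spec.2 N hN X
      exact ⟨S, hS, hXS, hS', fun h => absurd h hX⟩
  choose c hc1 hc2 hc3 hc4 using hchoice
  -- `S A` is a hull of `A` and all earlier `S B`, so the system is monotone, and coherence makes it
  -- `≺_K`-increasing. Only finitely many `B` occur, so sizes stay at most `LS(K)`.
  let below : (A : Finset N) → (∀ B, B ⊂ A → L.Substructure N) → Set N :=
    fun A g => A ∪ ⋃ B : {B // B ⊂ A}, (g B B.2 : Set N)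
  let S : Finset N → L.Substructure N := Finset.strongInduction fun A g => c (below A g)
  have hS : ∀ A, S A = c (below A fun B _ => S B) := fun A => Finset.strongInduction_eq _ A
  have hstrong : ∀ A, K.Strong (S A) := fun A => by rw [hS]; exact hc1 _
  have hmono : ∀ A B, A ⊆ B → S A ≤ S B := by
    intro A B hAB
    rcases hAB.eq_or_ssubset with rfl | h
    · exact le_rfl
    · intro x hx
      rw [hS B]
      exact hc2 _ (Or.inr (Set.mem_iUnion.2 ⟨⟨A, h⟩, hx⟩))
  refine ⟨S, fun A B h => Le.of_strong (hmono A B h) (hstrong A) (hstrong B), ?_, ?_, ?_⟩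
  · intro A
    induction A using Finset.strongInduction with
    | H A ih =>
    have hfin : Finite {B // B ⊂ A} :=
      Finite.of_injective (fun B : {B // B ⊂ A} => (⟨B.1, Finset.mem_powerset.2 B.2.1⟩ : A.powerset))
        fun x y h => Subtype.ext (Subtype.mk.inj h)
    rw [hS]
    refine (hc3 _).trans ?_
    refine (add_le_add (b := K.LS) (d := K.LS) ?_ le_rfl).trans_eq (add_eq_self K.aleph0_le_LS)
    refine (mk_union_le _ _).trans ?_
    refine (add_le_add (b := K.LS) (d := K.LS) ?_ ?_).trans_eq (add_eq_self K.aleph0_le_LS)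
    · exact (mk_le_aleph0 (α := A)).trans K.aleph0_le_LS
    · refine (mk_iUnion_le_sum_mk).trans ?_
      refine (sum_le_sum (fun B : {B // B ⊂ A} => #(S B.1)) (fun _ => K.LS) fun B => ih B.1 B.2).trans ?_
      rw [sum_const']
      exact (mul_le_mul_left (mk_le_aleph0.trans K.aleph0_le_LS) _).trans_eq
        (mul_eq_self K.aleph0_le_LS)
  · intro A x hx
    rw [hS]
    exact hc2 _ (Or.inl hx)
  · intro A
    induction A using Finset.strongInduction with
    | H A ih =>
    intro hA
    rw [hS]
    refine hc4 _ (Set.union_subset hA (Set.iUnion_subset fun B => ih B.1 B.2 ?_))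
    exact (Finset.coe_subset.2 B.2.1).trans hA

/-! ### Closure under ultraproducts when `LS(K) < κ` -/

/-- The ultraproducts of the small submodels form a `≺_K`-directed system indexed by the finite
subsets of the ultraproduct. The closure hypothesis makes `Y` the union of the part of this system
indexed by finite subsets of `Y`, so `Le.finsetUnion` applies to `Y` and the whole. -/
theorem strong_of_finset_systems [CardinalInterFilter (U : Filter α) κ] (hLS : K.LS < κ)
    {N : α → Type u} [∀ i, L.Structure (N i)] [∀ i, DecidableEq (N i)]
    {S : ∀ i, Finset (N i) → L.Substructure (N i)}
    (hS : ∀ i A B, A ⊆ B → K.Le (S i A) (S i B)) (hcard : ∀ i A, #(S i A) ≤ K.LS)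
    (hsub : ∀ i (A : Finset (N i)), (A : Set (N i)) ⊆ S i A) (Y : L.Substructure (UProd U N))
    (hY : ∀ A : Finset (UProd U N), (A : Set (UProd U N)) ⊆ Y →
      UProd.sub (U := U) (fun i => S i (A.image fun p => UProd.out p i)) ≤ Y) : K.Strong Y := by
  let S' : Finset (UProd U N) → L.Substructure (UProd U N) := fun A =>
    UProd.sub fun i => S i (A.image fun p => UProd.out p i)
  have hS' : ∀ A B, A ⊆ B → K.Le (S' A) (S' B) := fun A B hAB =>
    Le.ultraproduct K.aleph0_le_LS (le_self_add.trans K.LS_spec.1) hLS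
      (fun i => hS i _ _ (Finset.image_subset_image hAB)) fun i => hcard i _
  have hmono : Monotone S' := fun A B h => (hS' A B h).1
  have hsub' : ∀ (A : Finset (UProd U N)), ∀ p ∈ A, p ∈ S' A := fun A p hp =>
    UProd.mem_sub.2 (.of_forall fun i => hsub i _ (Finset.mem_coe.2 (Finset.mem_image_of_mem _ hp)))
  have hunion : ∀ Z : L.Substructure (UProd U N),
      (∀ A : Finset (UProd U N), (A : Set (UProd U N)) ⊆ Z → S' A ≤ Z) →
      finsetUnion S' (Z : Set (UProd U N)) = Z := by
    intro Z hZ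
    ext p
    rw [mem_finsetUnion hmono]
    constructor
    · rintro ⟨A, hA, hp⟩
      exact hZ A hA hp
    · intro hp
      exact ⟨{p}, by simpa using hp, hsub' _ p (Finset.mem_singleton_self p)⟩
  have h := Le.finsetUnion hS' (Set.subset_univ (Y : Set (UProd U N)))
  rw [hunion Y hY, ← Substructure.coe_top (L := L), hunion ⊤ fun _ _ => le_top] at h
  exact h.strong_of_top

theorem ultraClosed_of_LS_lt [CardinalInterFilter (U : Filter α) κ] (hLS : K.LS < κ) :
    K.UltraClosed U := by
  classical
  constructor
  · intro M N _ _ f hf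
    -- The systems respect the ranges of the `f i`, so finitely many points in the range of the
    -- ultraproduct map generate a submodel inside that range at almost every index.
    choose S hS hcard hsub hR using fun i => exists_finset_system (hf i)
    have : ∀ i, Nonempty (M i) := fun i => K.nonempty_of_mem _ (hf i).mem_left
    unfold IsEmb
    rw [UProd.map_range]
    refine strong_of_finset_systems hLS hS hcard hsub _ fun A hA => ?_
    have h1 : ∀ᶠ i in U, ∀ p : A, UProd.out p.1 i ∈ (f i).toHom.range :=
      eventually_all.2 fun p => UProd.mem_sub.1 (hA p.2)
    refine UProd.sub_mono (h1.mono fun i hi => hR i _ ?_)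
    intro x hx
    obtain ⟨p, hp, rfl⟩ := Finset.mem_image.1 (Finset.mem_coe.1 hx)
    exact hi ⟨p, hp⟩
  · intro P _ hP
    obtain ⟨S, hS, hcard, hsub, -⟩ := exists_finset_system (K.strong_top P hP)
    unfold IsEmb
    refine strong_of_finset_systems hLS (fun _ => hS) (fun _ => hcard) (fun _ => hsub) _
      fun A hA => ?_
    have hA' : ∀ p : A, ∃ x : P, UProd.diag (L := L) U P x = p.1 := fun p => hA p.2
    choose g hg using hA'
    have h1 : ∀ᶠ i in U, ∀ p : A, UProd.out p.1 i = g p := by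
      refine eventually_all.2 fun p => ?_
      rw [← hg p]
      exact UProd.out_mk _
    have h2 : ∀ᶠ i in U, S (A.image fun p => UProd.out p i) ≤ S (Finset.univ.image g) := by
      refine h1.mono fun i hi => (hS _ _ ?_).1
      intro x hx
      obtain ⟨p, hp, rfl⟩ := Finset.mem_image.1 hx
      exact Finset.mem_image.2 ⟨⟨p, hp⟩, Finset.mem_univ _, (hi ⟨p, hp⟩).symm⟩
    -- What remains is an ultrapower of one fixed model of size below `κ`; by completeness all its
    -- elements are diagonal.
    refine (UProd.sub_mono h2).trans fun p hp => ?_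
    have h3 := UProd.mem_sub.1 hp
    have : Nonempty (S (Finset.univ.image g)) := K.nonempty_of_mem _ (hS _ _ subset_rfl).mem_left
    let y : α → S (Finset.univ.image g) := fun i =>
      if h : UProd.out p i ∈ S (Finset.univ.image g) then ⟨_, h⟩ else Classical.arbitrary _
    obtain ⟨x, hx⟩ := Ultrafilter.exists_eventually_eq U ((hcard _).trans_lt hLS) y
    refine ⟨x, Eq.trans (UProd.mk_eq_mk.2 ?_) (UProd.mk_out p)⟩
    filter_upwards [h3, hx] with i hi hi'
    rw [← hi']
    simp only [y, dif_pos hi]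

end AEC

end SmallUltraproduct

/-! ### Ultraproducts and the logic `L_{κ,ω}` -/

section InfiniteLogic

open Filter

variable {L : FirstOrder.Language.{u, u}} {κ : Cardinal.{u}}

namespace InfFormula

theorem realize_equiv {M N : Type u} [L.Structure M] [L.Structure N] (e : M ≃[L] N) {n : ℕ}
    (φ : InfFormula L κ n) (v : Fin n → M) :
    φ.Realize (fun k => e (v k)) ↔ φ.Realize v := by
  induction φ with
  | equal t₁ t₂ =>
    have h := fun t : L.Term _ => HomClass.realize_term e (t := t) (v := v)
    change t₁.realize (e ∘ v) = t₂.realize (e ∘ v) ↔ t₁.realize v = t₂.realize v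
    rw [h, h, e.injective.eq_iff]
  | rel R t =>
    have h : (fun i => (t i).realize (e ∘ v)) = fun i => e ((t i).realize v) :=
      funext fun i => HomClass.realize_term e
    change Structure.RelMap R (fun i => (t i).realize (e ∘ v)) ↔ _
    rw [h]
    exact e.map_rel R _
  | neg φ ih => exact not_congr (ih v)
  | and φ ψ ih₁ ih₂ => exact and_congr (ih₁ v) (ih₂ v)
  | conj s hs φ ih => exact forall_congr' fun i => ih i v
  | all φ ih =>
    refine (e.surjective.forall).trans (forall_congr' fun x => ?_)
    rw [← ih]
    exact iff_of_eq (congrArg φ.Realize (Fin.comp_snoc (α := M) e v x).symm)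

variable {α : Type u} {U : Ultrafilter α} [CardinalInterFilter (U : Filter α) κ]

/-- Łoś's theorem for `L_{κ,ω}` and a `κ`-complete ultrafilter. -/
theorem realize_ultraproduct {M : α → Type u} [∀ i, L.Structure (M i)] [∀ i, Nonempty (M i)] {n : ℕ}
    (φ : InfFormula L κ n) (x : Fin n → ∀ i, M i) :
    φ.Realize (fun k => UProd.mk U (x k)) ↔ ∀ᶠ i in U, φ.Realize fun k => x k i := by
  induction φ with
  | equal t₁ t₂ =>
    unfold Realize
    rw [UProd.realize_mk, UProd.realize_mk, UProd.mk_eq_mk]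
  | rel R t =>
    unfold Realize
    simp only [UProd.realize_mk]
    exact UProd.relMap_mk R _
  | neg φ ih => exact (not_congr (ih x)).trans Ultrafilter.eventually_not.symm
  | and φ ψ ih₁ ih₂ => exact (and_congr (ih₁ x) (ih₂ x)).trans eventually_and.symm
  | conj s hs φ ih =>
    exact (forall_congr' fun i => ih i x).trans (eventually_cardinal_forall hs).symm
  | @all n φ ih =>
    have h (y : ∀ i, M i) : φ.Realize (Fin.snoc (α := fun _ => UProd U M)
        (fun k => UProd.mk U (x k)) (UProd.mk U y)) ↔
        ∀ᶠ i in U, φ.Realize (Fin.snoc (α := fun _ => M i) (fun k => x k i) (y i)) := by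
      have h1 := ih (Fin.snoc (α := fun _ => ∀ i, M i) x y)
      have h2 : (fun k => UProd.mk U (Fin.snoc (α := fun _ => ∀ i, M i) x y k)) =
          Fin.snoc (α := fun _ => UProd U M) (fun k => UProd.mk U (x k)) (UProd.mk U y) :=
        Fin.comp_snoc (UProd.mk U) x y
      have h3 : ∀ i, (fun k => Fin.snoc (α := fun _ => ∀ i, M i) x y k i) =
          Fin.snoc (α := fun _ => M i) (fun k => x k i) (y i) :=
        fun i => Fin.comp_snoc (fun z : ∀ i, M i => z i) x y
      rw [h2] at h1
      simpa only [h3] using h1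
    unfold Realize
    constructor
    · intro hall
      -- Choose `y i` to be a counterexample whenever one exists.
      have hex : ∀ i, ∃ y, φ.Realize (Fin.snoc (α := fun _ => M i) (fun k => x k i) y) →
          ∀ z, φ.Realize (Fin.snoc (α := fun _ => M i) (fun k => x k i) z) := by
        intro i
        by_contra! hi
        obtain ⟨-, z, hz⟩ := hi (Classical.arbitrary _)
        exact hz (hi z).1
      choose y hy using hex
      exact ((h y).1 (hall _)).mono hy
    · intro hall p
      obtain ⟨y, rfl⟩ := UProd.exists_mk p
      exact (h y).2 (hall.mono fun i hi => hi (y i))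

end InfFormula

namespace AEC

variable {K : AEC L} {T : Set (InfFormula L κ 0)} {F : ∀ n, Set (InfFormula L κ n)}

theorem IsModClass.isEmb_iff (hK : K.IsModClass T F) {M N : Type u} [L.Structure M] [L.Structure N]
    (f : M ↪[L] N) : K.IsEmb f ↔ K.Mem M ∧ K.Mem N ∧
      ∀ (n : ℕ), ∀ φ ∈ F n, ∀ v : Fin n → M, φ.Realize v ↔ φ.Realize fun k => f (v k) := by
  unfold IsEmb
  have hM : K.Mem M ↔ K.Mem f.toHom.range :=
    ⟨K.mem_of_equiv f.equivRange, K.mem_of_equiv f.equivRange.symm⟩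
  rw [hK.2, ← hK.1, ← hK.1, ← hM]
  refine and_congr_right fun _ => and_congr_right fun _ => forall₃_congr fun n φ _ => ?_
  constructor
  · intro h v
    rw [← φ.realize_equiv f.equivRange]
    exact h fun k => f.equivRange (v k)
  · intro h v
    obtain ⟨w, rfl⟩ : ∃ w : Fin n → M, v = fun k => f.equivRange (w k) :=
      ⟨fun k => f.equivRange.symm (v k), funext fun k => (f.equivRange.apply_symm_apply _).symm⟩
    rw [φ.realize_equiv]
    exact h w

variable {α : Type u} {U : Ultrafilter α} [CardinalInterFilter (U : Filter α) κ]

theorem IsModClass.mem_ultraproduct (hK : K.IsModClass T F) {M : α → Type u}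
    [∀ i, L.Structure (M i)] (hM : ∀ i, K.Mem (M i)) : K.Mem (UProd U M) := by
  have hne : ∀ i, Nonempty (M i) := fun i => K.nonempty_of_mem _ (hM i)
  refine (hK.1 _).2 ⟨⟨UProd.mk U fun i => Classical.arbitrary (M i)⟩, fun φ hφ => ?_⟩
  have h := φ.realize_ultraproduct (U := U) (M := M) Fin.elim0
  rw [Subsingleton.elim (fun k : Fin 0 => UProd.mk U (Fin.elim0 k : ∀ i, M i)) Fin.elim0] at h
  refine h.2 (.of_forall fun i => ?_)
  rw [Subsingleton.elim (fun k : Fin 0 => (Fin.elim0 k : ∀ i, M i) i) Fin.elim0]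
  exact ((hK.1 _).1 (hM i)).2 φ hφ

theorem IsModClass.ultraClosed (hK : K.IsModClass T F) : K.UltraClosed U := by
  constructor
  · intro M N _ _ f hf
    have hneM : ∀ i, Nonempty (M i) := fun i => K.nonempty_of_mem _ (hf i).mem_left
    have hneN : ∀ i, Nonempty (N i) := fun i => K.nonempty_of_mem _ (hf i).mem_right
    refine (hK.isEmb_iff _).2 ⟨hK.mem_ultraproduct fun i => (hf i).mem_left,
      hK.mem_ultraproduct fun i => (hf i).mem_right, fun n φ hφ v => ?_⟩
    obtain ⟨x, rfl⟩ := UProd.exists_mk_fun v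
    simp only [UProd.map_mk]
    rw [φ.realize_ultraproduct, φ.realize_ultraproduct fun k i => f i (x k i)]
    exact eventually_congr (.of_forall fun i => ((hK.isEmb_iff (f i)).1 (hf i)).2.2 n φ hφ _)
  · intro P _ hP
    have hne : Nonempty P := K.nonempty_of_mem _ hP
    refine (hK.isEmb_iff _).2 ⟨hP, hK.mem_ultraproduct fun _ => hP, fun n φ hφ v => ?_⟩
    simp only [UProd.diag_apply]
    rw [φ.realize_ultraproduct fun k _ => v k]
    exact eventually_const.symm

end AEC

end InfiniteLogic

/-! ### Equality of types and equality of their restrictions -/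

section UltraRestriction

open Filter

variable {L : FirstOrder.Language.{u, u}}

/-- The `n`-fold composition of a relation with itself. -/
def Relation.IterComp {β : Type*} (r : β → β → Prop) : ℕ → β → β → Prop
  | 0 => Eq
  | n + 1 => fun a b => ∃ c, Relation.IterComp r n a c ∧ r c b

/-- Recording the length of a chain allows the ultrafilter to make it constant. -/
theorem Relation.TransGen.exists_iterComp {β : Type*} {r : β → β → Prop} {a b : β}
    (h : Relation.TransGen r a b) : ∃ n, Relation.IterComp r n a b := by
  induction h with
  | single h => exact ⟨1, a, rfl, h⟩
  | tail _ h ih =>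
    obtain ⟨n, hn⟩ := ih
    exact ⟨n + 1, _, hn, h⟩

namespace AEC

variable {K : AEC L}

/-- Ultraproducts may be too large to be ambient models of pretypes; Löwenheim-Skolem cuts them
down. The set `B` pads the hull to exactly the prescribed size. -/
theorem exists_pretype {M N I : Type u} [L.Structure M] [L.Structure N] (hLS : K.LS ≤ #M)
    {f : M ↪[L] N} (hf : K.IsEmb f) (a : I → N) (hcard : #M + #I ≤ #N) :
    ∃ (D : Pretype K M I) (k : D.N ↪[L] N), K.IsEmb k ∧ (∀ m, k (D.incl m) = f m) ∧
      ∀ i, k (D.a i) = a i := by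
  set c : Cardinal.{u} := #M + #I with hc
  have hMc : #M ≤ c := le_self_add
  have hinf : ℵ₀ ≤ c := (K.aleph0_le_LS.trans hLS).trans hMc
  obtain ⟨B, hB⟩ := le_mk_iff_exists_set.1 hcard
  obtain ⟨T, hT, hA, hTcard⟩ := K.LS_spec.2 N hf.mem_right ((Set.range f ∪ Set.range a) ∪ B)
  have hTc : #T = c := by
    refine le_antisymm (hTcard.trans ?_) ?_
    · refine (add_le_add (b := c) (d := c) ?_ (hLS.trans hMc)).trans_eq (add_eq_self hinf)
      refine (mk_union_le _ _).trans ?_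
      refine (add_le_add (b := c) (d := c) ?_ hB.le).trans_eq (add_eq_self hinf)
      refine (mk_union_le _ _).trans ?_
      exact add_le_add mk_range_le mk_range_le
    · rw [← hB]
      exact mk_le_mk_of_subset (Set.subset_union_right.trans hA)
  have hfT : ∀ x, f x ∈ T := fun x => hA (Or.inl (Or.inl ⟨x, rfl⟩))
  exact ⟨⟨T, Embedding.codRestrict T f hfT, hf.codRestrict hT hfT, hTc,
    fun i => ⟨a i, hA (Or.inl (Or.inr ⟨i, rfl⟩))⟩⟩, T.subtype, isEmb_subtype hT, fun _ => rfl,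
    fun _ => rfl⟩

variable {α : Type u} {U : Ultrafilter α} {M I : Type u} [L.Structure M]
  {M' J : α → Type u} [∀ i, L.Structure (M' i)]

/-- `D`, a pretype over `M`, is contained in the ultraproduct of the pretypes `C i` over the
submodels `e i : M' i → M`. -/
def Pretype.IsUltraRestr (U : Ultrafilter α) (e : ∀ i, M' i ↪[L] M) (s : ∀ i, J i → I)
    (C : ∀ i, Pretype K (M' i) (J i)) (D : Pretype K M I) : Prop :=
  ∃ k : D.N ↪[L] UProd U fun i => (C i).N, K.IsEmb k ∧
    (∀ m, ∀ᶠ i in U, ∀ m', e i m' = m → UProd.out (k (D.incl m)) i = (C i).incl m') ∧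
    ∀ x, ∀ᶠ i in U, ∀ j, s i j = x → UProd.out (k (D.a x)) i = (C i).a j

variable {e : ∀ i, M' i ↪[L] M} {s : ∀ i, J i → I}

/-- The common target is the ultraproduct of the targets `N' i`. The maps agree at `m` and at `x`
because almost all pieces contain `m` and `x`. -/
theorem Pretype.IsUltraRestr.atomic (hU : K.UltraClosed U)
    (hM : ∀ m, ∀ᶠ i in U, ∃ m', e i m' = m) (hI : ∀ x, ∀ᶠ i in U, ∃ j, s i j = x)
    {C C' : ∀ i, Pretype K (M' i) (J i)} {D D' : Pretype K M I}
    (hD : Pretype.IsUltraRestr U e s C D) (hD' : Pretype.IsUltraRestr U e s C' D')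
    (h : ∀ i, (C i).Atomic (C' i)) : D.Atomic D' := by
  obtain ⟨k, hk, hk1, hk2⟩ := hD
  obtain ⟨k', hk', hk1', hk2'⟩ := hD'
  choose N' str f g hf hg h1 h2 using h
  refine ⟨UProd U N', inferInstance, (UProd.map U f).comp k, (UProd.map U g).comp k',
    (hU.map f hf).comp hk, (hU.map g hg).comp hk', fun m => ?_, fun x => ?_⟩
  · simp only [Embedding.comp_apply]
    rw [← UProd.mk_out (k (D.incl m)), ← UProd.mk_out (k' (D'.incl m)), UProd.map_mk, UProd.map_mk,
      UProd.mk_eq_mk]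
    filter_upwards [hM m, hk1 m, hk1' m] with i hi hi1 hi2
    obtain ⟨m', hm'⟩ := hi
    rw [hi1 m' hm', hi2 m' hm', h1]
  · simp only [Embedding.comp_apply]
    rw [← UProd.mk_out (k (D.a x)), ← UProd.mk_out (k' (D'.a x)), UProd.map_mk, UProd.map_mk,
      UProd.mk_eq_mk]
    filter_upwards [hI x, hk2 x, hk2' x] with i hi hi1 hi2
    obtain ⟨j, hj⟩ := hi
    rw [hi1 j hj, hi2 j hj, h2]

/-- The common target is the ultrapower of `P.N`: it receives `P.N` diagonally and `D.N` through the
ultraproduct of the embeddings of the `C i`. -/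
theorem Pretype.IsUltraRestr.atomic_of_isRestr (hU : K.UltraClosed U)
    (hM : ∀ m, ∀ᶠ i in U, ∃ m', e i m' = m) (hI : ∀ x, ∀ᶠ i in U, ∃ j, s i j = x)
    {C : ∀ i, Pretype K (M' i) (J i)} {D P : Pretype K M I}
    (hD : Pretype.IsUltraRestr U e s C D) (h : ∀ i, P.IsRestr (e i) (s i) (C i)) :
    D.Atomic P := by
  obtain ⟨k, hk, hk1, hk2⟩ := hD
  choose f hf h1 h2 using h
  refine ⟨UProd U fun _ => P.N, inferInstance, (UProd.map U f).comp k, UProd.diag U P.N,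
    (hU.map f hf).comp hk, hU.diag P.N P.isEmb.mem_right, fun m => ?_, fun x => ?_⟩
  · simp only [Embedding.comp_apply]
    rw [← UProd.mk_out (k (D.incl m)), UProd.map_mk, UProd.diag_apply, UProd.mk_eq_mk]
    filter_upwards [hM m, hk1 m] with i hi hi1
    obtain ⟨m', hm'⟩ := hi
    rw [hi1 m' hm', h1, hm']
  · simp only [Embedding.comp_apply]
    rw [← UProd.mk_out (k (D.a x)), UProd.map_mk, UProd.diag_apply, UProd.mk_eq_mk]
    filter_upwards [hI x, hk2 x] with i hi hi1
    obtain ⟨j, hj⟩ := hi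
    rw [hi1 j hj, h2, hj]

theorem Pretype.exists_isUltraRestr (hU : K.UltraClosed U) (hLS : K.LS ≤ #M)
    (he : ∀ i, K.IsEmb (e i)) (hs : ∀ i, Function.Injective (s i))
    (hM : ∀ m, ∀ᶠ i in U, ∃ m', e i m' = m) (hI : ∀ x, ∀ᶠ i in U, ∃ j, s i j = x)
    (C : ∀ i, Pretype K (M' i) (J i)) : ∃ D : Pretype K M I, Pretype.IsUltraRestr U e s C D := by
  classical
  have hneM : ∀ i, Nonempty (M' i) := fun i => K.nonempty_of_mem _ (he i).mem_left
  have hneC : ∀ i, Nonempty (C i).N := fun i => (hneM i).map (C i).incl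
  have hmem : K.Mem M := by
    obtain ⟨i⟩ := (U : Filter α).nonempty_of_neBot
    exact (he i).mem_right
  -- The diagonal of `M` lands in the ultraproduct of the pieces, since each `m` has a preimage at
  -- almost every index.
  obtain ⟨b, hb, hb'⟩ := (hU.map e he).exists_factor (hU.diag M hmem) (by
    intro m
    refine ⟨UProd.mk U fun i => Function.invFun (e i) m, UProd.mk_eq_mk.2 ?_⟩
    exact (hM m).mono fun i hi => Function.invFun_eq hi)
  have hb1 : ∀ m, ∀ᶠ i in U, e i (UProd.out (b m) i) = m := by
    intro m
    have h := hb' m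
    rw [← UProd.mk_out (b m), UProd.map_mk, UProd.diag_apply, UProd.mk_eq_mk] at h
    exact h
  -- the element of an ultraproduct that is given by the values at the preimages of `x`
  have hval : ∀ (g : ∀ i, J i → (C i).N) (x : I), ∃ y : ∀ i, (C i).N, ∀ i j, s i j = x →
      y i = g i j := by
    intro g x
    refine ⟨fun i => if h : ∃ j, s i j = x then g i h.choose else Classical.arbitrary _, ?_⟩
    intro i j hj
    have h : ∃ j, s i j = x := ⟨j, hj⟩
    simp only [dif_pos h]
    exact congrArg (g i) (hs i (h.choose_spec.trans hj.symm))
  choose a ha using hval fun i => (C i).a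
  -- The sequences `(C i).a` may have repetitions, so auxiliary injections are used to bound `|I|`
  -- by the size of the ultraproduct.
  have hJ : ∀ i, ∃ g : J i → (C i).N, Function.Injective g := by
    intro i
    have h : #(J i) ≤ #(C i).N := by
      rw [(C i).card_eq]
      exact le_add_self
    obtain ⟨g⟩ := Cardinal.le_def _ _ |>.1 h
    exact ⟨g, g.injective⟩
  choose g hg using hJ
  choose y hy using hval g
  have hIcard : #I ≤ #(UProd U fun i => (C i).N) := by
    refine mk_le_of_injective (f := fun x => UProd.mk U (y x)) fun x x' h => ?_
    obtain ⟨i, hi, ⟨j, hj⟩, j', hj'⟩ := ((UProd.mk_eq_mk.1 h).and ((hI x).and (hI x'))).exists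
    rw [hy x i j hj, hy x' i j' hj'] at hi
    rw [← hj, ← hj', hg i hi]
  have hf := (hU.map (fun i => (C i).incl) fun i => (C i).isEmb).comp hb
  have hMcard : #M ≤ #(UProd U fun i => (C i).N) := mk_le_of_injective (Embedding.injective _ :
    Function.Injective ((UProd.map U fun i => (C i).incl).comp b))
  have hcard : #M + #I ≤ #(UProd U fun i => (C i).N) :=
    add_le_of_le ((K.aleph0_le_LS.trans hLS).trans hMcard) hMcard hIcard
  obtain ⟨D, k, hk, hk1, hk2⟩ := exists_pretype hLS hf (fun x => UProd.mk U (a x)) hcard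
  refine ⟨D, k, hk, fun m => ?_, fun x => ?_⟩
  · rw [hk1, Embedding.comp_apply]
    conv in UProd.map _ _ _ => rw [← UProd.mk_out (b m), UProd.map_mk]
    filter_upwards [UProd.out_mk (U := U) fun i => (C i).incl (UProd.out (b m) i), hb1 m]
      with i hi hi' m' hm'
    rw [hi, (e i).injective (hi'.trans hm'.symm)]
  · rw [hk2]
    filter_upwards [UProd.out_mk (U := U) (a x)] with i hi j hj
    rw [hi, ha x i j hj]

theorem Pretype.IsUltraRestr.transGen (hU : K.UltraClosed U) (hLS : K.LS ≤ #M)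
    (he : ∀ i, K.IsEmb (e i)) (hs : ∀ i, Function.Injective (s i))
    (hM : ∀ m, ∀ᶠ i in U, ∃ m', e i m' = m) (hI : ∀ x, ∀ᶠ i in U, ∃ j, s i j = x) {n : ℕ}
    {C C' : ∀ i, Pretype K (M' i) (J i)} {D D' : Pretype K M I}
    (hD : Pretype.IsUltraRestr U e s C D) (hD' : Pretype.IsUltraRestr U e s C' D')
    (h : ∀ i, Relation.IterComp Pretype.Atomic n (C i) (C' i)) :
    Relation.TransGen Pretype.Atomic D D' := by
  induction n generalizing C' D' with
  -- Even for equal families, `D` and `D'` may be different submodels of the ultraproduct, so one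
  -- atomic step is needed.
  | zero => exact .single (hD.atomic hU hM hI hD' fun i => (h i : C i = C' i) ▸ .refl _)
  | succ n ih =>
    choose B hB hB' using h
    obtain ⟨E, hE⟩ := Pretype.exists_isUltraRestr hU hLS he hs hM hI B
    exact .tail (ih hE hB) (hE.atomic hU hM hI hD' hB')

/-- Varying both base and index set covers tameness (`s i = id`) and type shortness (`e i` the
identity) at once. -/
theorem GaloisType.eq_of_pullback_eq {κ : Cardinal.{u}} [CardinalInterFilter (U : Filter α) κ]
    (hκ : ℵ₀ < κ) (hU : K.UltraClosed U) (hLS : K.LS ≤ #M) (he : ∀ i, K.IsEmb (e i))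
    (hs : ∀ i, Function.Injective (s i)) (hLS' : ∀ i, K.LS ≤ #(M' i))
    (hM : ∀ m, ∀ᶠ i in U, ∃ m', e i m' = m) (hI : ∀ x, ∀ᶠ i in U, ∃ j, s i j = x)
    (p q : GaloisType K M I)
    (h : ∀ i, p.pullback (e i) (he i) (s i) (hs i) (hLS' i) =
      q.pullback (e i) (he i) (s i) (hs i) (hLS' i)) : p = q := by
  induction p using Quotient.inductionOn with | h P =>
  induction q using Quotient.inductionOn with | h Q =>
  choose C hC using fun i => P.exists_isRestr (e i) (he i) (s i) (hs i) (hLS' i)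
  choose C' hC' using fun i => Q.exists_isRestr (e i) (he i) (s i) (hs i) (hLS' i)
  have h1 : ∀ i, ∃ n : ULift.{u} ℕ, Relation.IterComp Pretype.Atomic n.down (C i) (C' i) := by
    intro i
    have h2 := h i
    rw [pullback_mk _ _ _ _ _ _ _ (hC i), pullback_mk _ _ _ _ _ _ _ (hC' i)] at h2
    obtain ⟨n, hn⟩ := Relation.TransGen.exists_iterComp (Quotient.exact h2)
    exact ⟨⟨n⟩, hn⟩
  choose n hn using h1
  have hnat : #(ULift.{u} ℕ) < κ := by rwa [mk_uLift, mk_nat, lift_aleph0]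
  -- Only here is `ℵ₀ < κ` needed: there are countably many possible lengths.
  obtain ⟨n₀, hn₀⟩ := Ultrafilter.exists_eventually_eq U hnat n
  -- reindex, so that all the chains have the same length
  obtain ⟨r, hr, hr'⟩ : ∃ r : α → α, (∀ᶠ i in U, r i = i) ∧ ∀ i, n (r i) = n₀ := by
    classical
    obtain ⟨i₀, hi₀⟩ := hn₀.exists
    refine ⟨fun i => if n i = n₀ then i else i₀, hn₀.mono fun i hi => if_pos hi, fun i => ?_⟩
    dsimp only
    by_cases hi : n i = n₀
    · rwa [if_pos hi]
    · rwa [if_neg hi]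
  have hreindex : ∀ p : α → Prop, (∀ᶠ i in U, p i) → ∀ᶠ i in U, p (r i) := fun p hp => by
    filter_upwards [hp, hr] with i hi hi'
    rwa [hi']
  have hM' := fun m => hreindex _ (hM m)
  have hI' := fun x => hreindex _ (hI x)
  obtain ⟨D, hD⟩ := Pretype.exists_isUltraRestr hU hLS (fun i => he (r i)) (fun i => hs (r i))
    hM' hI' fun i => C (r i)
  obtain ⟨D', hD'⟩ := Pretype.exists_isUltraRestr hU hLS (fun i => he (r i)) (fun i => hs (r i))
    hM' hI' fun i => C' (r i)
  have h3 := hD.transGen (n := n₀.down) hU hLS (fun i => he (r i)) (fun i => hs (r i)) hM' hI' hD'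
    fun i => hr' i ▸ hn (r i)
  have h4 := (hD.atomic_of_isRestr hU hM' hI' fun i => hC (r i)).symm
  have h5 := hD'.atomic_of_isRestr hU hM' hI' fun i => hC' (r i)
  exact Quotient.sound (s := Pretype.setoid K M I) (.head h4 (.tail h3 h5))

end AEC

end UltraRestriction

/-! ### Regularity of `κ`, and covers of sets whose size has cofinality `κ`. -/

section Measurable

open Filter

variable {κ : Cardinal.{u}} {U : Ultrafilter κ.out} [CardinalInterFilter (U : Filter κ.out) κ]

theorem Ultrafilter.eventually_notMem_of_card_lt (hU : ∀ a, {a} ∉ U) {A : Set κ.out} (hA : #A < κ) :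
    ∀ᶠ i in U, i ∉ A := by
  have h : ∀ᶠ i in (U : Filter κ.out), ∀ a : A, i ≠ a.1 := (eventually_cardinal_forall hA).2 fun a =>
    Ultrafilter.eventually_not.2 (hU a)
  exact h.mono fun i hi hiA => hi ⟨i, hiA⟩ rfl

/-- Otherwise `κ` would be a union of fewer than `κ` bounded sets, each of them null. -/
theorem Ultrafilter.cof_ord_eq (hκ : ℵ₀ < κ) (hU : ∀ a, {a} ∉ U) : κ.ord.cof = κ := by
  refine (Ordinal.cof_ord_le κ).antisymm ?_
  obtain ⟨f⟩ : Nonempty (κ.out ≃ κ.ord.ToType) := Cardinal.eq.1 (by simp)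
  rw [← Ordinal.cof_toType]
  obtain ⟨S, hS, hcard⟩ := Order.exists_cof_eq κ.ord.ToType
  rw [← hcard]
  by_contra! hlt
  have : NoMaxOrder κ.ord.ToType := Cardinal.noMaxOrder hκ.le
  have h : ∀ᶠ i in U, ∀ x : S, ¬ f i ≤ x := by
    refine (eventually_cardinal_forall hlt).2 fun x => ?_
    refine Ultrafilter.eventually_notMem_of_card_lt (A := {i | f i ≤ x}) hU ?_
    obtain ⟨y, hy⟩ := exists_gt (x : κ.ord.ToType)
    refine lt_of_le_of_lt ?_ ((Cardinal.mk_Iio_lt y (by simp)).trans_eq (by simp))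
    exact mk_le_of_injective (f := fun i : {i | f i ≤ x} => (⟨f i, i.2.trans_lt hy⟩ : Set.Iio y))
      fun a b hab => Subtype.ext (f.injective (Subtype.mk.inj hab))
  obtain ⟨i, hi⟩ := h.exists
  obtain ⟨x, hx, hix⟩ := hS (f i)
  exact hi ⟨x, hx⟩ hix

/-- A set of size `μ`, where `cf μ = κ`, is the union of sets `A i` of size `< μ` such that each
element is in almost all of the `A i`. -/
theorem Ultrafilter.exists_cover_of_cof_eq (hκ : ℵ₀ < κ) (hU : ∀ a, {a} ∉ U) {X : Type u}
    (hX : (#X).ord.cof = κ) : ∃ A : κ.out → Set X, (∀ i, #(A i) < #X) ∧ ∀ x, ∀ᶠ i in U, x ∈ A i := by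
  obtain ⟨f⟩ : Nonempty (κ.out ≃ κ.ord.ToType) := Cardinal.eq.1 (by simp)
  obtain ⟨g⟩ : Nonempty (X ≃ (#X).ord.ToType) := Cardinal.eq.1 (by simp)
  have : NoMaxOrder κ.ord.ToType := Cardinal.noMaxOrder hκ.le
  obtain ⟨S, hS, hcard⟩ := Order.exists_cof_eq (#X).ord.ToType
  rw [Ordinal.cof_toType, hX] at hcard
  obtain ⟨e⟩ : Nonempty (κ.out ≃ S) := Cardinal.eq.1 (by simp [hcard])
  have hIic : ∀ i, #{j | f j ≤ f i} < κ := by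
    intro i
    obtain ⟨y, hy⟩ := exists_gt (f i)
    refine lt_of_le_of_lt ?_ ((Cardinal.mk_Iio_lt y (by simp)).trans_eq (by simp))
    exact mk_le_of_injective
      (f := fun j : {j | f j ≤ f i} => (⟨f j, j.2.trans_lt hy⟩ : Set.Iio y))
      fun a b hab => Subtype.ext (f.injective (Subtype.mk.inj hab))
  -- The enumeration `e` of a cofinal set need not be increasing, hence the union over `j ≤ i`.
  -- These are fewer than `κ` points, so they are bounded and `A i` is small.
  refine ⟨fun i => {x | ∃ j, f j ≤ f i ∧ g x ≤ e j}, fun i => ?_, fun x => ?_⟩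
  · let B : Set (#X).ord.ToType := (fun j => (e j : (#X).ord.ToType)) '' {j | f j ≤ f i}
    have hB : ¬ IsCofinal B := by
      intro hB
      have h := Order.cof_le hB
      rw [Ordinal.cof_toType, hX] at h
      exact (h.trans mk_image_le).not_gt (hIic i)
    unfold IsCofinal at hB
    push Not at hB
    obtain ⟨b, hb⟩ := hB
    refine lt_of_le_of_lt ?_ ((Cardinal.mk_Iio_lt b (by simp)).trans_eq (by simp))
    refine mk_le_of_injective
      (f := fun x : {x | ∃ j, f j ≤ f i ∧ g x ≤ e j} => (⟨g x, ?_⟩ : Set.Iio b))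
      fun a b hab => Subtype.ext (g.injective (Subtype.mk.inj hab))
    obtain ⟨j, hj, hxj⟩ := x.2
    exact lt_of_le_of_lt hxj (hb _ ⟨j, hj, rfl⟩)
  · obtain ⟨y, hy, hxy⟩ := hS (g x)
    obtain ⟨j, hj⟩ := e.surjective ⟨y, hy⟩
    refine (Ultrafilter.eventually_notMem_of_card_lt hU (hIic j)).mono fun i hi => ?_
    refine ⟨j, (not_le.1 hi).le, ?_⟩
    rw [hj]
    exact hxy

end Measurable

/-! ### Tameness, type shortness and the theorem. -/

section Main

open Filter

variable {L : FirstOrder.Language.{u, u}} {K : AEC L} {κ : Cardinal.{u}} {U : Ultrafilter κ.out}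
  [CardinalInterFilter (U : Filter κ.out) κ]

namespace AEC

theorem UltraClosed.fullyTame (hUK : K.UltraClosed U) (hκ : ℵ₀ < κ) (hU : ∀ a, {a} ∉ U)
    {μ : Cardinal.{u}} (hLS : K.LS < μ) (hμ : μ.ord.cof = κ) : K.FullyTame μ μ := by
  rintro I M _ hM rfl p q hpq
  by_contra! hcon
  obtain ⟨A, hA, hA'⟩ := Ultrafilter.exists_cover_of_cof_eq (X := M) hκ hU hμ
  -- Adding a set of size `LS(K)` makes each hull large enough to carry types.
  obtain ⟨B, hB⟩ := le_mk_iff_exists_set.1 hLS.le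
  have hinf : ℵ₀ ≤ #M := K.aleph0_le_LS.trans hLS.le
  choose S hS hsub hcard using fun i => K.LS_spec.2 M hM (A i ∪ B)
  have hcard' : ∀ i, #(S i) < #M := fun i => (hcard i).trans_lt <|
    add_lt_of_lt hinf ((mk_union_le _ _).trans_lt (add_lt_of_lt hinf (hA i) (hB.trans_lt hLS))) hLS
  have hLS' : ∀ i, K.LS ≤ #(S i) := fun i =>
    hB.symm.le.trans (mk_le_mk_of_subset (Set.subset_union_right.trans (hsub i)))
  refine hpq (GaloisType.eq_of_pullback_eq (U := U) hκ hUK hLS.le (fun i => isEmb_subtype (hS i))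
    (s := fun _ => id) (fun _ => Function.injective_id) hLS' (fun m => ?_)
    (fun x => .of_forall fun _ => ⟨x, rfl⟩) p q fun i => hcon (S i) (hS i) (hLS' i) (hcard' i))
  exact (hA' m).mono fun i hi => ⟨⟨m, hsub i (Or.inl hi)⟩, rfl⟩

theorem UltraClosed.fullyTypeShort (hUK : K.UltraClosed U) (hκ : ℵ₀ < κ) (hU : ∀ a, {a} ∉ U)
    {μ : Cardinal.{u}} (hμ : μ.ord.cof = κ) : K.FullyTypeShort μ μ := by
  rintro θ M _ hM hLS - I rfl p q hpq
  by_contra! hcon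
  obtain ⟨A, hA, hA'⟩ := Ultrafilter.exists_cover_of_cof_eq (X := I) hκ hU hμ
  refine hpq (GaloisType.eq_of_pullback_eq (U := U) (e := fun _ => Embedding.refl L M)
    (s := fun i => (Subtype.val : A i → I)) hκ hUK hLS (fun _ => isEmb_refl hM)
    (fun _ => Subtype.val_injective) (fun _ => hLS) (fun m => .of_forall fun _ => ⟨m, rfl⟩)
    (fun x => (hA' x).mono fun i hi => ⟨⟨x, hi⟩, rfl⟩) p q fun i => hcon (A i) (hA i))

theorem EssentiallyBelow.ultraClosed (hK : K.EssentiallyBelow κ) : K.UltraClosed U := by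
  obtain h | ⟨T, F, -, -, h⟩ := hK
  · exact ultraClosed_of_LS_lt h
  · exact h.ultraClosed

end AEC

end Main

theorem mainTheorem5 {L : FirstOrder.Language.{u, u}} (K : AEC L) (κ : Cardinal.{u})
    (hκ : IsMeasurableCardinal κ) (hK : K.EssentiallyBelow κ) :
    (K.LS < κ → K.FullyTame κ κ) ∧
    ∀ μ : Cardinal.{u}, K.LS < μ → μ.ord.cof = κ →
      K.FullyTame μ μ ∧ K.FullyTypeShort μ μ := by
  obtain ⟨hκ, U, hcomplete, hU⟩ := hκ
  have hUK : K.UltraClosed U := hK.ultraClosed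
  -- By regularity of `κ`, the first claim is the case `λ = κ` of tameness.
  exact ⟨fun h => hUK.fullyTame hκ hU h (Ultrafilter.cof_ord_eq hκ hU),
    fun μ hμ hcof => ⟨hUK.fullyTame hκ hU hμ hcof, hUK.fullyTypeShort hκ hU hcof⟩⟩
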